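/- Let $k\subset\mathbb{C}$ be a subfield, let $a,b\in k$ with $a^3-27b^2\neq 0$, and let $E$ be the elliptic curve $y^2=4x^3-ax-b$ over $k$ with origin $O$. Let $\Lambda\subset\mathbb{C}$ be its period lattice, that is, the lattice with $g_2(\Lambda)=a$, $g_3(\Lambda)=b$, with Weierstrass functions $\wp,\zeta,\sigma$, so that $z\mapsto(\wp(z),\wp'(z))$ uniformizes $E(\mathbb{C})$ and $dx/y$ corresponds to $dz$. For $\lambda\in\Lambda$ let $\eta(\lambda)=\zeta(z)-\zeta(z+\lambda)$ (independent of $z\notin\Lambda$), and let $L=\{(\lambda,-\eta(\lambda)) : \lambda\in\Lambda\}\subset\mathbb{C}^2$. Write $(z,s)$ for the coordinates of $\mathbb{C}^2$. Let $\pi:E^\dagger\to E$ be the universal vectorial extension of $E$ and $D=\pi^{-1}(O)$. Explicitly, $E^\dagger$ is glued from the two affine charts $E^\dagger\setminus D=\operatorname{Spec}k[x,y,t]/(y^2-4x^3+ax+b)$ and $W\times\mathbb{A}^1$, where $W\subset E$ is the complement of the affine points with $xy=0$ and the fibre coordinate on $W\times\mathbb{A}^1$ is $t+\frac{y}{2x}$;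 the charts are glued along the locus $xy\ne0$. The divisor $D$ is given in the second chart by $u=0$, where $u=x/y$. The restriction to $D$ of the fibre coordinate $t+\frac{y}{2x}$ is the coordinate of $D\cong\mathbb{G}_a$, again denoted by $t$. Under the uniformization $\mathbb{C}^2/L\cong E^\dagger(\mathbb{C})$, given outside $z=0$ by $$(z,s)\mapsto(x,y,t)=(\wp(z),\wp'(z),\zeta(z)-s),$$ $D(\mathbb{C})$ corresponds to $\{z=0\}$, and the point $(0,s)$ has coordinate $t=-s$ on $D$. Let $\nu$ be the pull-back of the form $-dt-x\frac{dx}{y}$ to $(\mathbb{C}\setminus\Lambda)\times\mathbb{C}$. Define one-forms $\omega^{(n)}=f^{(n)}(z,s)\,dz$, $n\ge0$, on $(\mathbb{C}\setminus\Lambda)\times\mathbb{C}$ by the Laurent expansion at $w=0$ $$e^{-sw}\,\frac{\sigma(z+w)}{\sigma(z)\sigma(w)}\,dz=\sum_{n\ge0}\omega^{(n)}w^{n-1}.$$ Then the following hold. 1. For every $n\ge1$, the form $\omega^{(n)}$ descends to a meromorphic one-form on $\mathbb{C}^2/L$, holomorphic outside $z=0$, with a simple pole along $z=0$ and residue $\frac{t^{n-1}}{(n-1)!}$.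 That is, near $z=0$ it is $\frac{(-s)^{n-1}}{(n-1)!}\frac{dz}{z}$ plus a holomorphic one-form. 2. For every $n\ge1$, under the uniformization $\omega^{(n)}$ corresponds to a global one-form on $E^\dagger$ with logarithmic poles along $D$ that is defined over $k$, that is, to an element of $H^0(E^\dagger,\Omega^1_{E^\dagger/k}\langle D\rangle)$. The residue of this element along $D$ is $\frac{t^{n-1}}{(n-1)!}\in k[t]$. 3. On $(\mathbb{C}\setminus\Lambda)\times\mathbb{C}$ we have $d\nu=d\omega^{(0)}=0$, and $d\omega^{(n)}=-\nu\wedge\omega^{(n-1)}$ for all $n\ge1$. -/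

import Mathlib

open Filter Topology
open scoped Nat

noncomputable section

namespace UnivExt

/-! ### The Weierstrass functions of a lattice

`PeriodPair`, its lattice `Λ`, the functions `℘`, `℘'` and the invariants `g₂`, `g₃` are Mathlib's. -/

/-- The Weierstrass zeta function of the lattice `Λ`. -/
def zeta (L : PeriodPair) (z : ℂ) : ℂ :=
  1 / z + ∑' l : {l : L.lattice // l ≠ 0},
    (1 / (z - (l.1 : ℂ)) + 1 / (l.1 : ℂ) + z / (l.1 : ℂ) ^ 2)

/-- The Weierstrass sigma function of the lattice `Λ`. -/
def sigma (L : PeriodPair) (z : ℂ) : ℂ :=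
  z * ∏' l : {l : L.lattice // l ≠ 0},
    ((1 - z / (l.1 : ℂ)) * Complex.exp (z / (l.1 : ℂ) + z ^ 2 / (2 * (l.1 : ℂ) ^ 2)))

/-- The quasi-periods `η(λ) = ζ(z) - ζ(z + λ)`. The difference does not depend on `z ∉ Λ`;
half of the first period serves as the base point. -/
def eta (L : PeriodPair) (l : ℂ) : ℂ :=
  zeta L (L.ω₁ / 2) - zeta L (L.ω₁ / 2 + l)

/-- The subgroup of all pairs `(λ, -η(λ))`, `λ ∈ Λ`, of `ℂ²`. -/
def periodGroup (L : PeriodPair) : AddSubgroup (ℂ × ℂ) :=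
  AddSubgroup.closure (Set.range fun l : L.lattice => ((l : ℂ), -eta L (l : ℂ)))

/-- The preimage in `ℂ²` of the complement of the divisor `z = 0` in the quotient of `ℂ²` by
`periodGroup L`. -/
def puncturedSet (L : PeriodPair) : Set (ℂ × ℂ) := {p | p.1 ∉ L.lattice}

/-! ### The analytic one-forms

A one-form on (an open subset of) `ℂ²` with coordinates `(z, s)` is a function from `ℂ²` to the
dual of `ℂ²`. -/

/-- One-forms on `ℂ²`. -/
abbrev OneForm : Type := ℂ × ℂ → (ℂ × ℂ →L[ℂ] ℂ)

/-- The form `dz`. -/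
def dz : ℂ × ℂ →L[ℂ] ℂ := ContinuousLinearMap.fst ℂ ℂ ℂ

/-- The generating function `e^{-sw} σ(z + w) / (σ(z) σ(w))`. -/
def genFun (L : PeriodPair) (z s w : ℂ) : ℂ :=
  Complex.exp (-(s * w)) * sigma L (z + w) / (sigma L z * sigma L w)

/-- The coefficient `f⁽ⁿ⁾(z, s)` of `w ^ (n - 1)` in the Laurent expansion of the generating
function at its simple pole `w = 0`: the `n`-th Taylor coefficient of `w` times the generating
function, whose value at the removable singularity `w = 0` is `1`. -/
def coeffFun (L : PeriodPair) (n : ℕ) (z s : ℂ) : ℂ :=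
  iteratedDeriv n (Function.update (fun w => w * genFun L z s w) 0 1) 0 / (n ! : ℂ)

/-- The one-form `ω⁽ⁿ⁾ = f⁽ⁿ⁾(z, s) dz`. -/
def omegaForm (L : PeriodPair) (n : ℕ) : OneForm := fun p => coeffFun L n p.1 p.2 • dz

/-- The map `(z, s) ↦ (x, y, t) = (℘(z), ℘'(z), ζ(z) - s)`. -/
def unif (L : PeriodPair) (p : ℂ × ℂ) : Fin 3 → ℂ :=
  ![L.weierstrassP p.1, L.derivWeierstrassP p.1, zeta L p.1 - p.2]

/-- The form `ν = -dt - x dx/y` in the coordinates `(z, s)`, in which `dx/y` is `dz`. -/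
def nuForm (L : PeriodPair) : OneForm := fun p =>
  -fderiv ℂ (fun q => unif L q 2) p - unif L p 0 • dz

/-- A one-form as a differential form of degree one in Mathlib's sense. -/
def toForm (θ : OneForm) : ℂ × ℂ → (ℂ × ℂ) [⋀^Fin 1]→L[ℂ] ℂ :=
  fun p => ContinuousAlternatingMap.ofSubsingleton ℂ (ℂ × ℂ) ℂ (0 : Fin 1) (θ p)

/-- The wedge product of two covectors: `(α ∧ β)(v₀, v₁) = α(v₀) β(v₁) - α(v₁) β(v₀)`. -/
def wedge (α β : ℂ × ℂ →L[ℂ] ℂ) : (ℂ × ℂ) [⋀^Fin 2]→L[ℂ] ℂ :=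
  ContinuousAlternatingMap.alternatizeUncurryFin
    (α.smulRight (ContinuousAlternatingMap.ofSubsingleton ℂ (ℂ × ℂ) ℂ (0 : Fin 1) β))

theorem wedge_apply (α β : ℂ × ℂ →L[ℂ] ℂ) (v : Fin 2 → ℂ × ℂ) :
    wedge α β v = α (v 0) * β (v 1) - α (v 1) * β (v 0) := by
  simp [wedge, ContinuousAlternatingMap.alternatizeUncurryFin_apply, Fin.sum_univ_two,
    Fin.removeNth, sub_eq_add_neg]

/-- `θ` descends from `Λᶜ × ℂ` to a one-form on the complement of the divisor `z = 0` in the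
quotient of `ℂ²` by `periodGroup L`. The cotangent spaces of the quotient are identified with the
dual of `ℂ²` through translations, as `dz` and `ds` are translation invariant. -/
def Descends (L : PeriodPair) (θ : OneForm) : Prop :=
  ∃ θ' : (ℂ × ℂ) ⧸ periodGroup L → (ℂ × ℂ →L[ℂ] ℂ),
    ∀ p ∈ puncturedSet L, θ p = θ' (QuotientAddGroup.mk p)

/-- `θ` has at most a simple pole along `z = 0`, with (Poincaré) residue `r`: near every point of
`z = 0` it is `r dz/z` plus a holomorphic one-form. Points of the divisor `z = 0` carry the
coordinate `t` of the kernel of the projection `(z, s) ↦ z`; as `(x, y, t) = (℘, ℘', ζ - s)`, the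
translation by `(0, -t)` of `ℂ²` adds `t` to the third coordinate. So `t` is the coordinate of
`(0, -t)`, and `(0, s)` has the coordinate `-s`. -/
def HasPoleWithResidue (L : PeriodPair) (θ : OneForm) (r : Polynomial ℂ) : Prop :=
  ∃ g : OneForm, AnalyticOnNhd ℂ g {p | p.1 ∈ L.lattice → p.1 = 0} ∧
    ∀ p ∈ puncturedSet L, θ p = (r.eval (-p.2) / p.1) • dz + g p

/-! ### The universal vectorial extension and its logarithmic one-forms

Let `E` be the elliptic curve `y² = 4x³ - ax - b` over the field `k` of characteristic zero.
Its universal vectorial extension `E† → E` is trivial over `E` minus the origin and over a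
neighbourhood of the origin, with fibre coordinates `t` and `t + y/(2x)`:
as `t` is `ζ(z) - s`, it has the polar part `1/z` at the origin, and `y/(2x)` has the polar part
`-1/z`. So `E†` is glued from two smooth affine charts.

* The complement of the fibre `D` over the origin, with ring of functions
  `k[x, y, t] / (y² - 4x³ + ax + b)`.
* The part of `E†` over the complement of the affine points of `E` with `xy = 0`. Here
  `u = x/y` is a coordinate function with a simple zero at the origin and no other zero,
  and `e = x³/y²` is invertible; the ring of functions is generated by `u`, `e`, `e⁻¹` and
  `t + y/(2x)`. The equation of `D` is `u = 0`, and the restriction of `t + y/(2x)` to `D` is the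
  coordinate of `D`.

The intersection of the charts is the locus `xy ≠ 0` of the first. All the rings are integral
domains, smooth over `k`, so that functions and differentials restrict injectively. -/

section Algebraic

variable (k : Type*) [Field k] (a b : k)

/-- The ring of functions on `E†` minus `D`: `k[x, y, t] / (y² - 4x³ + ax + b)`. -/
abbrev Chart : Type _ :=
  MvPolynomial (Fin 3) k ⧸ Ideal.span
    {(MvPolynomial.X 1 ^ 2 - 4 * MvPolynomial.X 0 ^ 3 + MvPolynomial.C a * MvPolynomial.X 0
      + MvPolynomial.C b : MvPolynomial (Fin 3) k)}

/-- The coordinate functions `x`, `y`, `t`, numbered by `0`, `1`, `2`. -/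
def coord (i : Fin 3) : Chart k a b := Ideal.Quotient.mk _ (MvPolynomial.X i)

/-- The ring of functions on the intersection of the two charts. -/
abbrev Overlap : Type _ := Localization.Away (coord k a b 0 * coord k a b 1)

/-- The coordinate functions on the intersection of the charts. -/
def ocoord (i : Fin 3) : Overlap k a b := algebraMap (Chart k a b) (Overlap k a b) (coord k a b i)

/-- The function `1/(xy)` on the intersection of the charts. -/
def invXY : Overlap k a b := IsLocalization.Away.invSelf (coord k a b 0 * coord k a b 1)

/-- The function `1/x`. -/
def invX : Overlap k a b := ocoord k a b 1 * invXY k a b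

/-- The function `1/y`. -/
def invY : Overlap k a b := ocoord k a b 0 * invXY k a b

/-- The function `u = x/y`, an equation of `D` in the second chart. -/
def locU : Overlap k a b := ocoord k a b 0 * invY k a b

/-- The fibre coordinate `t + y/(2x)` of the second chart. -/
def locT : Overlap k a b := ocoord k a b 2 + (2⁻¹ : k) • (ocoord k a b 1 * invX k a b)

/-- The ring of functions on the second chart, as a subring of the functions on the
intersection. -/
def chartAtD : Subalgebra k (Overlap k a b) :=
  Algebra.adjoin k {locU k a b,
    ocoord k a b 0 ^ 3 * invY k a b ^ 2,
    ocoord k a b 1 ^ 2 * invX k a b ^ 3,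
    locT k a b}

/-- The algebraic one-forms on `E†` minus `D`. -/
abbrev AlgForm : Type _ := KaehlerDifferential k (Chart k a b)

/-- The algebraic one-forms on the intersection of the charts. -/
abbrev OverlapForm : Type _ := KaehlerDifferential k (Overlap k a b)

/-- The restriction of one-forms to the intersection of the charts. -/
def restrictForm : AlgForm k a b →ₗ[k] OverlapForm k a b :=
  (KaehlerDifferential.map k k (Chart k a b) (Overlap k a b)).restrictScalars k

/-- The form `du/u`. -/
def dlogU : OverlapForm k a b :=
  (ocoord k a b 1 * invX k a b) • KaehlerDifferential.D k (Overlap k a b) (locU k a b)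

/-- The regular one-forms on the second chart. -/
def regularAtD : Submodule (chartAtD k a b) (OverlapForm k a b) :=
  Submodule.span (chartAtD k a b)
    (KaehlerDifferential.D k (Overlap k a b) '' (chartAtD k a b : Set (Overlap k a b)))

/-- The one-forms on the second chart with logarithmic poles along `D`: the module generated by
the regular ones and `du/u`. -/
def logAtD : Submodule (chartAtD k a b) (OverlapForm k a b) :=
  regularAtD k a b ⊔ Submodule.span (chartAtD k a b) {dlogU k a b}

/-- The `k`-vector space of global one-forms on `E†` with logarithmic poles along `D`: the
one-forms on the complement of `D` whose restriction to the intersection of the charts comes from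
a one-form on the second chart with logarithmic poles along `D`. -/
def logForms : Submodule k (AlgForm k a b) :=
  ((logAtD k a b).restrictScalars k).comap (restrictForm k a b)

/-- The one-form `α` is logarithmic along `D` with residue the polynomial `r` in the coordinate
of `D`. -/
def HasAlgResidue (α : AlgForm k a b) (r : Polynomial k) : Prop :=
  restrictForm k a b α - (Polynomial.aeval (locT k a b) r) • dlogU k a b ∈ regularAtD k a b

/-- The pull-back of the algebraic one-form `α` on `E†` minus `D` under the
uniformization `(z, s) ↦ (x, y, t) = (℘(z), ℘'(z), ζ(z) - s)` is `θ`: if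
`α = P dx + Q dy + R dt`, then the pull-back is obtained by substitution in `P`, `Q`, `R` and in
the differentials `dx`, `dy`, `dt`. -/
def PullsBackTo [Algebra k ℂ] (L : PeriodPair) (α : AlgForm k a b) (θ : OneForm) : Prop :=
  ∃ c : Fin 3 → MvPolynomial (Fin 3) k,
    α = ∑ i, (Ideal.Quotient.mk _ (c i) : Chart k a b) •
      KaehlerDifferential.D k (Chart k a b) (coord k a b i) ∧
    ∀ p ∈ puncturedSet L,
      θ p = ∑ i, MvPolynomial.aeval (unif L p) (c i) • fderiv ℂ (fun q => unif L q i) p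

end Algebraic

end UnivExt

end

/-! Write `K(z, w) = w σ(z + w) / (σ(z) σ(w))` (`kernel`). The generating function is `e^{-sw} K /
w`, and the proof rests on splitting the exponential in three ways.

Splitting off `e^{-sw}` gives `f⁽ⁿ⁾ = ∑ (-s)^i / i! · g_j(z)` over `i + j = n`, with `g_j` the
Taylor coefficients of `K` in `w`. As `σ(z) K(z, w)` becomes `w` at `z = 0`, only `g_1` has a pole
there, with polar part `1/z`; this is the residue (`kernelCoeff_eq_add`). The same sum gives
`∂f⁽ⁿ⁺¹⁾/∂s = -f⁽ⁿ⁾`, and `ζ' = -℘` gives `ν = ds`, whence the formula for `dω⁽ⁿ⁾`. Descent follows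
from the quasi-periodicity of `ζ` and `σ` (`genFun_add_coe`).

Splitting off `e^{tw}` with `t = ζ(z) - s` gives `f⁽ⁿ⁾ = ∑ t^i / i! · c_j(z)`, with `c_j` the
coefficients of `e^{-ζ(z)w} K`. The logarithmic derivative of this function in `w` is `ζ(z + w) -
ζ(z) - (ζ(w) - 1/w)`. Its coefficients involve only derivatives of `℘` at `z` and Laurent
coefficients of `℘` at `0`, so `℘'' = 6℘² - g₂/2` places them in `k[℘, ℘']`, and a recursion does
the same for `c_j` (`isPoly_twistCoeff`). Since the discriminant is nonzero, `dx/y` is a polynomial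
combination of `dx` and `dy`, so `ω⁽ⁿ⁾` comes from a form over `k` off `D`.

Splitting off `e^{Tw}` with `T = t + y/(2x)` replaces `c_j` by coefficients `d_j`. Here `d_0 = 1`,
`d_1 = -y/(2x)`, and `d_j` is bounded near `z = 0` for `j ≥ 2`, because `ζ + ℘'/(2℘)` vanishes at
the origin. Writing `x^j d_j = P(x) + y Q(x)`, boundedness limits the degrees of `P` and `Q`, and
hence `d_j` is regular on the second chart (`exists_reduced_chartPoly`, `invX_pow_mul_reduced_mem`).
The only pole comes from `d_1 dx/y`, which is `du/u` up to a regular form, so the residue is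
`T^{n-1}/(n-1)!` (`hasAlgResidue_polyForm`). -/

noncomputable section

namespace UnivExt

/-! ### The Weierstrass zeta function -/

section

variable (L : PeriodPair)

/-- The function `ζ(z) - 1/z`, as a sum over the whole lattice. -/
def zetaExcept (z : ℂ) : ℂ :=
  ∑' l : L.lattice, if (l : ℂ) = 0 then 0 else (1 / (z - l) + 1 / (l : ℂ) + z / (l : ℂ) ^ 2)

theorem zeta_eq (z : ℂ) : zeta L z = 1 / z + zetaExcept L z := by
  rw [zeta, zetaExcept]
  congr 1
  have := tsum_subtype {l : L.lattice | l ≠ 0}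
    (fun l : L.lattice => (1 / (z - (l : ℂ)) + 1 / (l : ℂ) + z / (l : ℂ) ^ 2))
  refine this.trans ?_
  congr 1
  ext l
  by_cases h : l = 0 <;> simp [Set.indicator, h]

/-- The three fractions combine to `s² / ((s - l) l²)`, of order `|l|⁻³`; in a lattice of rank two
the exponent `3 > 2` makes the sum converge. -/
theorem norm_zetaTerm_le (r : ℝ) (hr : 0 < r) (s : ℂ) (hs : ‖s‖ < r) (l : ℂ) (h : 2 * r ≤ ‖l‖) :
    ‖1 / (s - l) + 1 / l + s / l ^ 2‖ ≤ 2 * r ^ 2 * ‖l‖ ^ (-3 : ℝ) := by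
  have h0 : 0 < ‖l‖ := by linarith
  have hl : l ≠ 0 := norm_pos_iff.mp h0
  have h1 : ‖l‖ / 2 ≤ ‖s - l‖ := by
    rw [norm_sub_rev]
    exact .trans (by linarith) (norm_sub_norm_le l s)
  have hsl : s - l ≠ 0 := norm_pos_iff.mp (by linarith)
  have e : 1 / (s - l) + 1 / l + s / l ^ 2 = s ^ 2 / ((s - l) * l ^ 2) := by
    field_simp
    ring
  rw [e, norm_div, norm_mul, norm_pow, norm_pow]
  calc ‖s‖ ^ 2 / (‖s - l‖ * ‖l‖ ^ 2) ≤ r ^ 2 / (‖l‖ / 2 * ‖l‖ ^ 2) := by gcongr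
    _ = 2 * r ^ 2 / ‖l‖ ^ 3 := by field
    _ = _ := by
      rw [Real.rpow_neg (norm_nonneg _), div_eq_mul_inv]
      norm_cast

theorem summable_norm_lattice_rpow : Summable fun l : L.lattice => ‖l‖ ^ (-3 : ℝ) :=
  ZLattice.summable_norm_rpow _ _ (by simp; norm_num)

theorem hasSumLocallyUniformly_zetaExcept :
    HasSumLocallyUniformly (fun (l : L.lattice) (z : ℂ) =>
      if (l : ℂ) = 0 then 0 else (1 / (z - l) + 1 / (l : ℂ) + z / (l : ℂ) ^ 2)) (zetaExcept L) := by
  refine L.hasSumLocallyUniformly_aux (u := fun r l => 2 * r ^ 2 * ‖l‖ ^ (-3 : ℝ)) _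
    (fun _ _ => (summable_norm_lattice_rpow L).mul_left _) fun r hr =>
    Filter.eventually_atTop.mpr ⟨2 * r, ?_⟩
  rintro _ h s hs l rfl
  split_ifs
  · simp only [norm_zero]; positivity
  · exact norm_zetaTerm_le r hr s hs l h

theorem hasDerivAt_zetaTerm {z l : ℂ} (hz : z - l ≠ 0) :
    HasDerivAt (fun z => 1 / (z - l) + 1 / l + z / l ^ 2) (-(1 / (z - l) ^ 2 - 1 / l ^ 2)) z := by
  have h1 : HasDerivAt (fun z : ℂ => z - l) 1 z := (hasDerivAt_id z).sub_const l
  have h2 := ((h1.inv hz).add_const (1 / l)).add ((hasDerivAt_id z).div_const (l ^ 2))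
  convert! h2 using 1
  · ext w; simp
  · simp; ring

theorem sub_ne_zero_of_mem_compl {z : ℂ} (hz : z ∈ ((L.lattice : Set ℂ) \ {0})ᶜ) {l : L.lattice}
    (hl : (l : ℂ) ≠ 0) : z - l ≠ 0 := by
  intro h
  apply hz
  rw [sub_eq_zero.mp h]
  exact ⟨l.2, hl⟩

theorem differentiableOn_zetaSum (s : Finset L.lattice) :
    DifferentiableOn ℂ (fun z => ∑ l ∈ s,
      if (l : ℂ) = 0 then 0 else (1 / (z - l) + 1 / (l : ℂ) + z / (l : ℂ) ^ 2))
      ((L.lattice : Set ℂ) \ {0})ᶜ := by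
  refine .fun_sum fun l _ => ?_
  split_ifs with hl
  · simp
  · intro z hz
    exact (hasDerivAt_zetaTerm
      (sub_ne_zero_of_mem_compl L hz hl)).differentiableAt.differentiableWithinAt

theorem differentiableOn_zetaExcept :
    DifferentiableOn ℂ (zetaExcept L) ((L.lattice : Set ℂ) \ {0})ᶜ :=
  (hasSumLocallyUniformly_zetaExcept L).hasSumLocallyUniformlyOn.differentiableOn
    (.of_forall fun s => differentiableOn_zetaSum L s) L.isOpen_compl_lattice_sdiff

/-- Local uniform convergence allows termwise differentiation; the differentiated partial sums are
minus those of `℘ - 1/z²`. -/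
theorem deriv_zetaExcept {z : ℂ} (hz : z ∈ ((L.lattice : Set ℂ) \ {0})ᶜ) :
    deriv (zetaExcept L) z = -L.weierstrassPExcept 0 z := by
  refine tendsto_nhds_unique (((hasSumLocallyUniformly_zetaExcept
    L).tendstoLocallyUniformlyOn.deriv (.of_forall fun s => differentiableOn_zetaSum L s)
      L.isOpen_compl_lattice_sdiff).tendsto_at hz) ?_
  have h := (L.hasSum_weierstrassPExcept 0 z).neg
  refine Tendsto.congr (fun s => ?_) h
  simp only [Function.comp_apply]
  refine (HasDerivAt.deriv (HasDerivAt.fun_sum fun l _ => ?_)).symm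
  split_ifs with hl
  · simpa using hasDerivAt_const z (0 : ℂ)
  · exact hasDerivAt_zetaTerm (sub_ne_zero_of_mem_compl L hz hl)

theorem hasDerivAt_zetaExcept {z : ℂ} (hz : z ∈ ((L.lattice : Set ℂ) \ {0})ᶜ) :
    HasDerivAt (zetaExcept L) (-L.weierstrassPExcept 0 z) z := by
  rw [← deriv_zetaExcept L hz]
  exact ((differentiableOn_zetaExcept L).differentiableAt
    (L.isOpen_compl_lattice_sdiff.mem_nhds hz)).hasDerivAt

theorem zetaExcept_zero : zetaExcept L 0 = 0 := by
  have : ∀ l : L.lattice, (if (l : ℂ) = 0 then 0 else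
      (1 / (0 - (l : ℂ)) + 1 / (l : ℂ) + 0 / (l : ℂ) ^ 2)) = 0 := by
    intro l
    split_ifs <;> simp
  simp only [zetaExcept, this, tsum_zero]

theorem ne_zero_of_notMem {z : ℂ} (hz : z ∉ L.lattice) : z ≠ 0 := by
  rintro rfl; exact hz L.lattice.zero_mem

theorem hasDerivAt_zeta {z : ℂ} (hz : z ∉ L.lattice) :
    HasDerivAt (zeta L) (-L.weierstrassP z) z := by
  have hz0 := ne_zero_of_notMem L hz
  have h1 := (hasDerivAt_inv hz0).add (hasDerivAt_zetaExcept L (z := z) (fun h => hz h.1))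
  have h2 := L.weierstrassPExcept_add 0 z
  convert! h1 using 1
  · ext w; rw [zeta_eq]; simp
  · rw [← h2]
    simp

/-! ### The sigma function -/

/-- The elementary factor `(1 - z/l) exp(z/l + z²/(2l²))`. -/
def sigmaFactor (l z : ℂ) : ℂ := (1 - z / l) * Complex.exp (z / l + z ^ 2 / (2 * l ^ 2))

/-- Division by zero yields `0`, so the lattice point `0` contributes a harmless factor and the
product may run over the whole lattice. -/
theorem sigmaFactor_zero_left (z : ℂ) : sigmaFactor 0 z = 1 := by simp [sigmaFactor]

theorem sigmaFactor_zero_right (l : ℂ) : sigmaFactor l 0 = 1 := by simp [sigmaFactor]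

/-- The Weierstrass product `σ(z)/z`, as a product over the whole lattice. -/
def sigmaProd (z : ℂ) : ℂ := ∏' l : L.lattice, sigmaFactor l z

theorem sigma_eq (z : ℂ) : sigma L z = z * sigmaProd L z := by
  rw [sigma, sigmaProd]
  congr 1
  have := tprod_subtype {l : L.lattice | l ≠ 0} (fun l : L.lattice => sigmaFactor l z)
  refine this.trans ?_
  congr 1
  ext l
  by_cases h : l = 0
  · simp [Set.mulIndicator, h, sigmaFactor_zero_left]
  · simp [Set.mulIndicator, h]

/-- The factor is the exponential of `log(1 - u) + u + u²/2`, a Taylor remainder of size at most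
`|u|³`; then `|e^v - 1| ≤ 2|v|` for `|v| ≤ 1`. -/
theorem norm_elementaryFactor_sub_one_le {u : ℂ} (hu : ‖u‖ ≤ 1 / 2) :
    ‖(1 - u) * Complex.exp (u + u ^ 2 / 2) - 1‖ ≤ 2 * ‖u‖ ^ 3 := by
  have hu1 : ‖u‖ < 1 := by linarith
  have h1 := Complex.norm_log_sub_logTaylor_le 2 (z := -u) (by simpa using hu1)
  have hT : Complex.logTaylor (2 + 1) (-u) = -(u + u ^ 2 / 2) := by
    simp [Complex.logTaylor, Finset.sum_range_succ]
    ring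
  rw [hT, ← sub_eq_add_neg, sub_neg_eq_add, norm_neg] at h1
  have hne : 1 - u ≠ 0 := by
    intro h
    rw [← sub_eq_zero.mp h] at hu1
    simp at hu1
  have h2 : ‖Complex.log (1 - u) + (u + u ^ 2 / 2)‖ ≤ ‖u‖ ^ 3 := by
    refine h1.trans ?_
    have : (1 - ‖u‖)⁻¹ ≤ 2 := by
      rw [inv_le_comm₀ (by linarith) (by norm_num)]
      linarith
    calc ‖u‖ ^ (2 + 1) * (1 - ‖u‖)⁻¹ / ((2 : ℕ) + 1) ≤ ‖u‖ ^ 3 * 2 / ((2 : ℕ) + 1) := by gcongr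
      _ ≤ ‖u‖ ^ 3 := by
        push_cast
        have := pow_nonneg (norm_nonneg u) 3
        linarith
  have h3 : (1 - u) * Complex.exp (u + u ^ 2 / 2)
      = Complex.exp (Complex.log (1 - u) + (u + u ^ 2 / 2)) := by
    rw [Complex.exp_add _ (u + u ^ 2 / 2), Complex.exp_log hne]
  rw [h3]
  have h4 : ‖u‖ ^ 3 ≤ 1 := pow_le_one₀ (norm_nonneg _) hu1.le
  exact (Complex.norm_exp_sub_one_le (h2.trans h4)).trans (by linarith)

theorem norm_sigmaFactor_sub_one_le (r : ℝ) (s : ℂ) (hs : ‖s‖ < r) (l : ℂ)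
    (h : 2 * r ≤ ‖l‖) : ‖sigmaFactor l s - 1‖ ≤ 2 * r ^ 3 * ‖l‖ ^ (-3 : ℝ) := by
  have h0 : 0 < ‖l‖ := by linarith [norm_nonneg s]
  have hu : ‖s / l‖ ≤ 1 / 2 := by
    rw [norm_div, div_le_div_iff₀ h0 (by norm_num)]
    linarith
  have e : sigmaFactor l s = (1 - s / l) * Complex.exp (s / l + (s / l) ^ 2 / 2) := by
    rw [sigmaFactor]; congr 2; ring
  rw [e]
  refine (norm_elementaryFactor_sub_one_le hu).trans ?_
  rw [norm_div, div_pow, Real.rpow_neg (norm_nonneg _), div_eq_mul_inv, mul_assoc]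
  norm_cast
  gcongr

theorem finite_lattice_norm_lt (r : ℝ) : {l : L.lattice | ‖l‖ < r}.Finite :=
  (isCompact_iff_finite.mp (isCompact_closedBall (0 : L.lattice) r)).subset
    fun l hl => by simpa using (le_of_lt hl)

theorem eventually_norm_sigmaFactor_le (r : ℝ) :
    ∀ᶠ l : L.lattice in cofinite, ∀ s ∈ Metric.ball (0 : ℂ) r,
      ‖sigmaFactor l s - 1‖ ≤ 2 * r ^ 3 * ‖l‖ ^ (-3 : ℝ) := by
  refine (finite_lattice_norm_lt L (2 * r)).subset fun l hl => ?_
  by_contra h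
  refine hl fun s hs => norm_sigmaFactor_sub_one_le r s (by simpa using hs) l ?_
  simpa using h

theorem differentiable_sigmaFactor (l : ℂ) : Differentiable ℂ (sigmaFactor l) := by
  unfold sigmaFactor
  fun_prop

theorem hasProdLocallyUniformlyOn_sigmaProd (r : ℝ) :
    HasProdLocallyUniformlyOn (fun l : L.lattice => sigmaFactor l) (sigmaProd L)
      (Metric.ball 0 r) := by
  have := Summable.hasProdLocallyUniformlyOn_one_add (K := Metric.ball (0 : ℂ) r)
    (f := fun (l : L.lattice) z => sigmaFactor l z - 1) Metric.isOpen_ball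
    ((summable_norm_lattice_rpow L).mul_left (2 * r ^ 3))
    (eventually_norm_sigmaFactor_le L r)
    (fun l => ((differentiable_sigmaFactor l).continuous.sub continuous_const).continuousOn)
  simp only [add_sub_cancel] at this
  exact this

theorem differentiable_sigmaProd : Differentiable ℂ (sigmaProd L) := by
  intro z
  have hz : z ∈ Metric.ball (0 : ℂ) (‖z‖ + 1) := by simp
  have := (hasProdLocallyUniformlyOn_sigmaProd L (‖z‖ + 1)).differentiableOn
    (.of_forall fun s => ?_) Metric.isOpen_ball
  · exact this.differentiableAt (Metric.isOpen_ball.mem_nhds hz)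
  · exact (Differentiable.fun_finsetProd (u := s) (f := fun l : L.lattice => sigmaFactor l)
      fun l _ => differentiable_sigmaFactor l).differentiableOn

theorem differentiable_sigma : Differentiable ℂ (sigma L) := by
  have : sigma L = fun z => z * sigmaProd L z := funext (sigma_eq L)
  rw [this]
  exact differentiable_id.mul (differentiable_sigmaProd L)

theorem sigmaFactor_ne_zero {l z : ℂ} (h : z ≠ l ∨ l = 0) : sigmaFactor l z ≠ 0 := by
  rcases eq_or_ne l 0 with rfl | hl
  · simp [sigmaFactor]
  · refine mul_ne_zero ?_ (Complex.exp_ne_zero _)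
    rw [sub_ne_zero, ne_comm, Ne, div_eq_one_iff_eq hl]
    simpa [hl] using h

theorem sigmaProd_ne_zero {z : ℂ} (hz : z ∈ ((L.lattice : Set ℂ) \ {0})ᶜ) :
    sigmaProd L z ≠ 0 := by
  have h := tprod_one_add_ne_zero_of_summable (f := fun l : L.lattice => sigmaFactor l z - 1)
    (fun l => ?_) ?_
  · simpa [sigmaProd] using h
  · rw [add_sub_cancel]
    refine sigmaFactor_ne_zero ?_
    by_contra! h
    exact hz (h.1 ▸ ⟨l.2, h.2⟩)
  · refine .of_norm_bounded_eventually
      ((summable_norm_lattice_rpow L).mul_left (2 * (‖z‖ + 1) ^ 3)) ?_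
    filter_upwards [eventually_norm_sigmaFactor_le L (‖z‖ + 1)] with l hl
    simpa using hl z (by simp)

theorem sigma_ne_zero {z : ℂ} (hz : z ∉ L.lattice) : sigma L z ≠ 0 := by
  rw [sigma_eq]
  exact mul_ne_zero (ne_zero_of_notMem L hz) (sigmaProd_ne_zero L fun h => hz h.1)

theorem sigma_eq_zero {z : ℂ} (hz : z ∈ L.lattice) : sigma L z = 0 := by
  rw [sigma_eq]
  rcases eq_or_ne z 0 with rfl | h0
  · simp
  · rw [sigmaProd, tprod_of_exists_eq_zero, mul_zero]
    exact ⟨⟨z, hz⟩, by simp [sigmaFactor, h0]⟩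

theorem sigmaProd_zero : sigmaProd L 0 = 1 := by
  simp [sigmaProd, sigmaFactor_zero_right]

theorem logDeriv_sigmaFactor {l z : ℂ} (hl : l ≠ 0) (hz : z - l ≠ 0) :
    logDeriv (sigmaFactor l) z = 1 / (z - l) + 1 / l + z / l ^ 2 := by
  have h1 : HasDerivAt (fun z : ℂ => 1 - z / l) (-(1 / l)) z :=
    ((hasDerivAt_id z).div_const l).const_sub 1
  have h2 : HasDerivAt (fun z : ℂ => z / l + z ^ 2 / (2 * l ^ 2)) (1 / l + z / l ^ 2) z := by
    convert! ((hasDerivAt_id z).div_const l).add ((hasDerivAt_pow 2 z).div_const (2 * l ^ 2)) using 1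
    simp; field_simp
  have h3 : HasDerivAt (sigmaFactor l) _ z := h1.mul h2.cexp
  rw [logDeriv_apply, h3.deriv, sigmaFactor]
  have h4 : 1 - z / l ≠ 0 := by
    rw [one_sub_div hl]
    exact div_ne_zero (by rw [← neg_sub]; exact neg_ne_zero.mpr hz) hl
  have h5 : l - z ≠ 0 := by rw [← neg_sub]; exact neg_ne_zero.mpr hz
  have h6 := Complex.exp_ne_zero (z / l + z ^ 2 / (2 * l ^ 2))
  field_simp
  ring

/-- The logarithmic derivative of the product is taken factor by factor; each factor contributes the
corresponding term of the zeta series. -/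
theorem deriv_sigmaProd {z : ℂ} (hz : z ∈ ((L.lattice : Set ℂ) \ {0})ᶜ) :
    deriv (sigmaProd L) z = zetaExcept L z * sigmaProd L z := by
  have hne := sigmaProd_ne_zero L hz
  have hlog : ∀ l : L.lattice, logDeriv (sigmaFactor l) z =
      if (l : ℂ) = 0 then 0 else (1 / (z - l) + 1 / (l : ℂ) + z / (l : ℂ) ^ 2) := by
    intro l
    split_ifs with hl
    · have : sigmaFactor (l : ℂ) = fun _ => 1 := by ext w; rw [hl, sigmaFactor_zero_left]
      simp [this, logDeriv_apply]
    · exact logDeriv_sigmaFactor hl (sub_ne_zero_of_mem_compl L hz hl)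
  have h := logDeriv_tprod_eq_tsum (f := fun l : L.lattice => sigmaFactor l) (x := z)
    (s := Metric.ball 0 (‖z‖ + 1)) Metric.isOpen_ball (by simp)
    (fun l => sigmaFactor_ne_zero (by by_contra! h; exact hz (h.1 ▸ ⟨l.2, h.2⟩)))
    (fun l => (differentiable_sigmaFactor l).differentiableOn)
    (by simp only [hlog]; exact (hasSumLocallyUniformly_zetaExcept L).hasSum.summable)
    (hasProdLocallyUniformlyOn_sigmaProd L _).multipliableLocallyUniformlyOn hne
  simp only [hlog] at h
  rw [logDeriv_apply] at h
  exact (div_eq_iff hne).mp h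

theorem hasDerivAt_sigma {z : ℂ} (hz : z ∉ L.lattice) :
    HasDerivAt (sigma L) (zeta L z * sigma L z) z := by
  have h : HasDerivAt (fun w => w * sigmaProd L w) _ z :=
    (hasDerivAt_id z).mul (differentiable_sigmaProd L z).hasDerivAt
  rw [deriv_sigmaProd L fun h => hz h.1] at h
  have e : sigma L = fun z => z * sigmaProd L z := funext (sigma_eq L)
  rw [e]
  convert! h using 1
  have := ne_zero_of_notMem L hz
  rw [zeta_eq]
  simp only [id]
  field_simp

/-! ### Quasi-periodicity -/

/-- Removing a countable set from a real vector space of dimension two leaves it path connected. -/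
theorem isPreconnected_compl_lattice : IsPreconnected ((L.lattice : Set ℂ)ᶜ) := by
  have : Countable L.lattice := L.latticeEquivProd.toEquiv.countable_iff.mpr inferInstance
  exact ((Set.to_countable (L.lattice : Set ℂ)).isPathConnected_compl_of_one_lt_rank
    (by rw [Complex.rank_real_complex]; norm_num)).isConnected.isPreconnected

theorem isOpen_compl_lattice : IsOpen ((L.lattice : Set ℂ)ᶜ) := L.isClosed_lattice.isOpen_compl

theorem add_notMem {z l : ℂ} (hz : z ∉ L.lattice) (hl : l ∈ L.lattice) : z + l ∉ L.lattice :=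
  fun h => hz ((L.lattice.add_mem_iff_left hl).mp h)

/-- A function with vanishing derivative off the lattice is constant there. -/
theorem eq_of_hasDerivAt_zero {f : ℂ → ℂ} (hf : ∀ z ∉ L.lattice, HasDerivAt f 0 z) {z w : ℂ}
    (hz : z ∉ L.lattice) (hw : w ∉ L.lattice) : f z = f w :=
  (isOpen_compl_lattice L).is_const_of_deriv_eq_zero (isPreconnected_compl_lattice L)
    (fun x hx => (hf x hx).differentiableAt.differentiableWithinAt)
    (fun x hx => (hf x hx).deriv) hz hw

theorem zeta_add_coe {z l : ℂ} (hz : z ∉ L.lattice) (hl : l ∈ L.lattice) :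
    zeta L (z + l) = zeta L z - eta L l := by
  have h := eq_of_hasDerivAt_zero L (f := fun z => zeta L z - zeta L (z + l)) (fun w hw => ?_) hz
    L.ω₁_div_two_notMem_lattice
  · rw [eta, ← h]; ring
  · have h1 := (hasDerivAt_zeta L (add_notMem L hw hl)).comp_add_const w l
    rw [L.weierstrassP_add_coe w ⟨l, hl⟩] at h1
    convert! (hasDerivAt_zeta L hw).sub h1 using 1
    ring

/-- Off the lattice, `σ(z + l) e^{η(l) z} / σ(z)` has logarithmic derivative `ζ(z + l) + η(l) - ζ(z)
= 0`, so it is constant. At lattice points both sides vanish. -/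
theorem exists_sigma_add_coe {l : ℂ} (hl : l ∈ L.lattice) :
    ∃ C : ℂ, C ≠ 0 ∧ ∀ z, sigma L (z + l) = C * Complex.exp (-(eta L l * z)) * sigma L z := by
  set w₀ := L.ω₁ / 2
  have h0 : w₀ ∉ L.lattice := L.ω₁_div_two_notMem_lattice
  refine ⟨sigma L (w₀ + l) * Complex.exp (eta L l * w₀) / sigma L w₀, ?_, fun z => ?_⟩
  · exact div_ne_zero (mul_ne_zero (sigma_ne_zero L (add_notMem L h0 hl)) (Complex.exp_ne_zero _))
      (sigma_ne_zero L h0)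
  by_cases hz : z ∈ L.lattice
  · rw [sigma_eq_zero L hz, sigma_eq_zero L (L.lattice.add_mem hz hl), mul_zero]
  have h := eq_of_hasDerivAt_zero L
    (f := fun z => sigma L (z + l) * Complex.exp (eta L l * z) / sigma L z) (fun w hw => ?_) hz h0
  · rw [← h, Complex.exp_neg]
    have := sigma_ne_zero L hz
    have := Complex.exp_ne_zero (eta L l * z)
    field_simp
  · have h1 := (hasDerivAt_sigma L (add_notMem L hw hl)).comp_add_const w l
    have h2 : HasDerivAt (fun z => Complex.exp (eta L l * z))
        (Complex.exp (eta L l * w) * (eta L l * 1)) w :=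
      ((hasDerivAt_id w).const_mul (eta L l)).cexp
    have hs := sigma_ne_zero L hw
    convert! (h1.mul h2).div (hasDerivAt_sigma L hw) hs using 1
    rw [zeta_add_coe L hw hl, Pi.mul_apply]
    field_simp
    ring

/-- The sigma quotient acquires the factor `e^{-η(l) w}`, which the shift of `s` compensates. No
condition on `z` is needed: the constants cancel even where a denominator is zero. -/
theorem genFun_add_coe {l : ℂ} (hl : l ∈ L.lattice) (z s w : ℂ) :
    genFun L (z + l) (s - eta L l) w = genFun L z s w := by
  obtain ⟨C, hC, h⟩ := exists_sigma_add_coe L hl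
  rw [genFun, genFun, h, show z + l + w = z + w + l by ring, h,
    show -((s - eta L l) * w) = -(s * w) + eta L l * w by ring, Complex.exp_add,
    show -(eta L l * (z + w)) = -(eta L l * z) + -(eta L l * w) by ring, Complex.exp_add,
    Complex.exp_neg (eta L l * w)]
  have h1 := Complex.exp_ne_zero (eta L l * w)
  have h2 := Complex.exp_ne_zero (-(eta L l * z))
  field_simp

end

section

/-! ### Taylor series as formal power series -/

/-- The Taylor series at `0`. -/
def taylor (f : ℂ → ℂ) : PowerSeries ℂ := PowerSeries.mk fun n => iteratedDeriv n f 0 / (n ! : ℂ)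

theorem coeff_taylor (f : ℂ → ℂ) (n : ℕ) :
    PowerSeries.coeff n (taylor f) = iteratedDeriv n f 0 / (n ! : ℂ) := by
  simp [taylor]

theorem coeff_zero_taylor (f : ℂ → ℂ) : PowerSeries.coeff 0 (taylor f) = f 0 := by
  simp [coeff_taylor]

theorem taylor_congr {f g : ℂ → ℂ} (h : f =ᶠ[𝓝 0] g) : taylor f = taylor g := by
  ext n
  rw [coeff_taylor, coeff_taylor, h.iteratedDeriv_eq]

theorem taylor_mul {f g : ℂ → ℂ} (hf : AnalyticAt ℂ f 0) (hg : AnalyticAt ℂ g 0) :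
    taylor (fun w => f w * g w) = taylor f * taylor g := by
  ext n
  have h := iteratedDeriv_mul (n := n) (f := f) (g := g) (x := 0) hf.contDiffAt hg.contDiffAt
  rw [coeff_taylor, PowerSeries.coeff_mul, Finset.Nat.sum_antidiagonal_eq_sum_range_succ
    (fun i j => PowerSeries.coeff i (taylor f) * PowerSeries.coeff j (taylor g))]
  change iteratedDeriv n (f * g) 0 / _ = _
  rw [h, Finset.sum_div]
  refine Finset.sum_congr rfl fun i hi => ?_
  have hi' : i ≤ n := Nat.lt_succ_iff.mp (Finset.mem_range.mp hi)
  rw [coeff_taylor, coeff_taylor, Nat.cast_choose ℂ hi']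
  have := Nat.cast_ne_zero (R := ℂ).mpr n.factorial_ne_zero
  field_simp

theorem taylor_add {f g : ℂ → ℂ} (hf : AnalyticAt ℂ f 0) (hg : AnalyticAt ℂ g 0) :
    taylor (fun w => f w + g w) = taylor f + taylor g := by
  ext n
  rw [map_add, coeff_taylor, coeff_taylor, coeff_taylor, ← add_div]
  congr 1
  exact iteratedDeriv_add hf.contDiffAt hg.contDiffAt

theorem taylor_const_mul (c : ℂ) {f : ℂ → ℂ} (hf : AnalyticAt ℂ f 0) :
    taylor (fun w => c * f w) = c • taylor f := by
  ext n
  rw [map_smul, coeff_taylor, coeff_taylor, smul_eq_mul, mul_div_assoc']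
  congr 1
  exact iteratedDeriv_const_mul c hf.contDiffAt

theorem taylor_deriv (f : ℂ → ℂ) : taylor (deriv f) = PowerSeries.derivative ℂ (taylor f) := by
  ext n
  rw [PowerSeries.coeff_derivative, coeff_taylor, coeff_taylor, ← iteratedDeriv_succ',
    Nat.factorial_succ]
  have := Nat.cast_ne_zero (R := ℂ).mpr n.factorial_ne_zero
  push_cast
  field_simp

theorem taylor_exp (c : ℂ) :
    taylor (fun w => Complex.exp (c * w)) = PowerSeries.rescale c (PowerSeries.exp ℂ) := by
  ext n
  rw [coeff_taylor, PowerSeries.coeff_rescale, PowerSeries.coeff_exp, iteratedDeriv_cexp_const_mul]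
  simp [div_eq_mul_inv]

theorem taylor_id : taylor (fun w => w) = PowerSeries.X := by
  ext n
  rw [coeff_taylor, PowerSeries.coeff_X]
  rcases n with _ | _ | n
  · simp
  · simp
  · rw [iteratedDeriv_succ', iteratedDeriv_succ']
    have : deriv (fun w : ℂ => w) = fun _ => 1 := by ext; simp
    rw [this, deriv_const']
    simp

theorem hasSum_taylor {f : ℂ → ℂ} (hf : AnalyticAt ℂ f 0) :
    ∀ᶠ w in 𝓝 (0 : ℂ), HasSum (fun n => PowerSeries.coeff n (taylor f) * w ^ n) (f w) := by
  filter_upwards [hf.hasFPowerSeriesAt.eventually_hasSum] with w hw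
  simp only [zero_add] at hw
  refine hw.congr_fun fun n => ?_
  simp [coeff_taylor, mul_comm]

/-! ### Coefficients of the generating function -/

variable (L : PeriodPair)

/-- The function `w σ(z + w) / (σ(z) σ(w))` of `w`, extended to `w = 0`. -/
def kernel (z w : ℂ) : ℂ := sigma L (z + w) / (sigma L z * sigmaProd L w)

/-- The Taylor coefficients of `kernel L z`. -/
def kernelCoeff (n : ℕ) (z : ℂ) : ℂ := PowerSeries.coeff n (taylor (kernel L z))

/-- Since `σ(w) = w · sigmaProd`, the removable singularity is removed explicitly; the prescribed
value `1` agrees with that of the kernel at `w = 0`. -/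
theorem update_genFun {z : ℂ} (hz : z ∉ L.lattice) (s : ℂ) :
    Function.update (fun w => w * genFun L z s w) 0 1
      = fun w => Complex.exp (-s * w) * kernel L z w := by
  have hs := sigma_ne_zero L hz
  ext w
  rcases eq_or_ne w 0 with rfl | hw
  · simp [kernel, sigmaProd_zero, hs]
  · rw [Function.update_of_ne hw, genFun, kernel, sigma_eq L w, neg_mul]
    field_simp

theorem zero_mem_compl : (0 : ℂ) ∈ ((L.lattice : Set ℂ) \ {0})ᶜ := by simp

theorem analyticAt_inv_sigmaProd : AnalyticAt ℂ (fun w => (sigmaProd L w)⁻¹) 0 :=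
  ((differentiable_sigmaProd L).analyticAt 0).inv (sigmaProd_ne_zero L (zero_mem_compl L))

theorem analyticAt_sigma_add (z : ℂ) : AnalyticAt ℂ (fun w => sigma L (z + w)) 0 :=
  ((differentiable_sigma L).comp (differentiable_id.const_add z)).analyticAt 0

theorem kernel_eq (z : ℂ) :
    kernel L z = fun w => (sigma L z)⁻¹ * (sigma L (z + w) * (sigmaProd L w)⁻¹) := by
  ext w
  rw [kernel, div_eq_mul_inv, mul_inv]
  ring

theorem analyticAt_kernel (z : ℂ) : AnalyticAt ℂ (kernel L z) 0 := by
  rw [kernel_eq]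
  exact analyticAt_const.mul ((analyticAt_sigma_add L z).mul (analyticAt_inv_sigmaProd L))

theorem analyticAt_exp_mul (c : ℂ) : AnalyticAt ℂ (fun w => Complex.exp (c * w)) 0 := by
  fun_prop

theorem analyticAt_exp_mul_kernel (c z : ℂ) :
    AnalyticAt ℂ (fun w => Complex.exp (c * w) * kernel L z w) 0 :=
  (analyticAt_exp_mul c).mul (analyticAt_kernel L z)

theorem coeff_taylor_exp_mul_kernel (c z : ℂ) (n : ℕ) :
    PowerSeries.coeff n (taylor fun w => Complex.exp (c * w) * kernel L z w)
      = ∑ ij ∈ Finset.HasAntidiagonal.antidiagonal n, c ^ ij.1 / (ij.1 ! : ℂ) * kernelCoeff L ij.2 z := by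
  rw [taylor_mul (analyticAt_exp_mul c) (analyticAt_kernel L z), taylor_exp, PowerSeries.coeff_mul]
  refine Finset.sum_congr rfl fun ij _ => ?_
  rw [PowerSeries.coeff_rescale, PowerSeries.coeff_exp, kernelCoeff]
  simp [div_eq_mul_inv]

theorem coeffFun_eq_coeff {z : ℂ} (hz : z ∉ L.lattice) (n : ℕ) (s : ℂ) :
    coeffFun L n z s
      = PowerSeries.coeff n (taylor fun w => Complex.exp (-s * w) * kernel L z w) := by
  rw [coeffFun, update_genFun L hz, coeff_taylor]

theorem coeffFun_eq_sum {z : ℂ} (hz : z ∉ L.lattice) (n : ℕ) (s : ℂ) :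
    coeffFun L n z s
      = ∑ ij ∈ Finset.HasAntidiagonal.antidiagonal n, (-s) ^ ij.1 / (ij.1 ! : ℂ) * kernelCoeff L ij.2 z := by
  rw [coeffFun_eq_coeff L hz, coeff_taylor_exp_mul_kernel]

theorem kernelCoeff_zero {z : ℂ} (hz : z ∉ L.lattice) : kernelCoeff L 0 z = 1 := by
  rw [kernelCoeff, coeff_zero_taylor, kernel, sigmaProd_zero, add_zero, mul_one,
    div_self (sigma_ne_zero L hz)]

theorem coeffFun_zero {z : ℂ} (hz : z ∉ L.lattice) (s : ℂ) : coeffFun L 0 z s = 1 := by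
  simp [coeffFun_eq_sum L hz, kernelCoeff_zero L hz]

theorem hasSum_genFun {z : ℂ} (hz : z ∉ L.lattice) (s : ℂ) : ∀ᶠ w in 𝓝[≠] (0 : ℂ),
    HasSum (fun n : ℕ => coeffFun L n z s * w ^ ((n : ℤ) - 1)) (genFun L z s w) := by
  have h := hasSum_taylor (analyticAt_exp_mul_kernel L (-s) z)
  filter_upwards [nhdsWithin_le_nhds h, self_mem_nhdsWithin] with w hw hw0
  have hw0 : w ≠ 0 := hw0
  have e := congrFun (update_genFun L hz s) w
  rw [Function.update_of_ne hw0] at e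
  rw [← e] at hw
  convert! hw.mul_left w⁻¹ using 1
  · ext n
    rw [coeffFun_eq_coeff L hz, zpow_sub₀ hw0, zpow_natCast, zpow_one]
    ring
  · field_simp

/-- The numerator of `kernelCoeff L n`, an entire function. -/
def kernelNum (n : ℕ) (z : ℂ) : ℂ :=
  PowerSeries.coeff n (taylor (fun w => sigma L (z + w)) * taylor fun w => (sigmaProd L w)⁻¹)

theorem kernelCoeff_eq (n : ℕ) (z : ℂ) : kernelCoeff L n z = (sigma L z)⁻¹ * kernelNum L n z := by
  rw [kernelCoeff, kernel_eq, taylor_const_mul, taylor_mul, kernelNum, map_smul, smul_eq_mul]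
  · exact analyticAt_sigma_add L z
  · exact analyticAt_inv_sigmaProd L
  · exact (analyticAt_sigma_add L z).mul (analyticAt_inv_sigmaProd L)

theorem differentiable_kernelNum (n : ℕ) : Differentiable ℂ (kernelNum L n) := by
  unfold kernelNum
  simp only [PowerSeries.coeff_mul]
  refine Differentiable.fun_sum fun ij _ => Differentiable.mul_const ?_ _
  simp only [coeff_taylor]
  refine Differentiable.div_const ?_ _
  have h : (fun z => iteratedDeriv ij.1 (fun w => sigma L (z + w)) 0)
      = iteratedDeriv ij.1 (sigma L) := by
    ext z
    rw [iteratedDeriv_comp_const_add]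
    simp
  rw [h]
  exact (differentiable_sigma L).contDiff.differentiable_iteratedDeriv _ (WithTop.coe_lt_top _)

/-- At `z = 0` the numerator is the expansion of `σ(w) / (σ(w)/w) = w`. This is the sole source of
the pole. -/
theorem kernelNum_zero (n : ℕ) : kernelNum L n 0 = if n = 1 then 1 else 0 := by
  have h : (fun w => sigma L (0 + w) * (sigmaProd L w)⁻¹) =ᶠ[𝓝 0] fun w => w := by
    filter_upwards [L.isOpen_compl_lattice_sdiff.mem_nhds (zero_mem_compl L)] with w hw
    rw [zero_add, sigma_eq, mul_assoc, mul_inv_cancel₀ (sigmaProd_ne_zero L hw), mul_one]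
  rw [kernelNum, ← taylor_mul (analyticAt_sigma_add L 0) (analyticAt_inv_sigmaProd L),
    taylor_congr h, taylor_id, PowerSeries.coeff_X]

/-- The regular part at `z = 0` of `kernelCoeff L n`. -/
def kernelReg (n : ℕ) : ℂ → ℂ := dslope (fun z => kernelNum L n z * (sigmaProd L z)⁻¹) 0

theorem analyticOnNhd_kernelReg (n : ℕ) :
    AnalyticOnNhd ℂ (kernelReg L n) ((L.lattice : Set ℂ) \ {0})ᶜ := by
  refine DifferentiableOn.analyticOnNhd ?_ L.isOpen_compl_lattice_sdiff
  rw [kernelReg, Complex.differentiableOn_dslope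
    (L.isOpen_compl_lattice_sdiff.mem_nhds (zero_mem_compl L))]
  exact (differentiable_kernelNum L n).differentiableOn.mul
    ((differentiable_sigmaProd L).differentiableOn.inv fun z hz => sigmaProd_ne_zero L hz)

/-- The coefficient is `F(z)/z` with `F` holomorphic near `0`; the polar part is `F(0)/z` and the
rest is the divided slope of `F`. -/
theorem kernelCoeff_eq_add {z : ℂ} (hz : z ∉ L.lattice) (n : ℕ) :
    kernelCoeff L n z = (if n = 1 then 1 else 0) / z + kernelReg L n z := by
  have hz0 := ne_zero_of_notMem L hz
  rw [kernelReg, dslope_of_ne _ hz0, slope_def_field, kernelNum_zero, sigmaProd_zero,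
    kernelCoeff_eq, sigma_eq]
  have := sigmaProd_ne_zero L (z := z) fun h => hz h.1
  field_simp
  split_ifs <;> ring

theorem analyticOnNhd_kernelCoeff (n : ℕ) :
    AnalyticOnNhd ℂ (kernelCoeff L n) (L.lattice : Set ℂ)ᶜ := by
  have : kernelCoeff L n = fun z => (sigma L z)⁻¹ * kernelNum L n z :=
    funext (kernelCoeff_eq L n)
  rw [this]
  intro z hz
  exact (((differentiable_sigma L).analyticAt z).inv (sigma_ne_zero L hz)).mul
    ((differentiable_kernelNum L n).analyticAt z)

/-! ### Descent, poles, exterior derivatives -/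

theorem isOpen_puncturedSet : IsOpen (puncturedSet L) :=
  (isOpen_compl_lattice L).preimage continuous_fst

theorem analyticAt_coeffSum {f : ℕ → ℂ → ℂ} {p : ℂ × ℂ} (hf : ∀ n, AnalyticAt ℂ (f n) p.1)
    (n : ℕ) : AnalyticAt ℂ (fun p : ℂ × ℂ =>
      ∑ ij ∈ Finset.HasAntidiagonal.antidiagonal n, (-p.2) ^ ij.1 / (ij.1 ! : ℂ) * f ij.2 p.1) p := by
  refine Finset.analyticAt_fun_sum _ fun ij _ => ?_
  refine AnalyticAt.mul ?_ ((hf ij.2).comp analyticAt_fst)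
  exact (analyticAt_snd.neg.pow _).div_const

theorem eventuallyEq_coeffFun {p : ℂ × ℂ} (hp : p ∈ puncturedSet L) (n : ℕ) :
    (fun q : ℂ × ℂ => ∑ ij ∈ Finset.HasAntidiagonal.antidiagonal n,
      (-q.2) ^ ij.1 / (ij.1 ! : ℂ) * kernelCoeff L ij.2 q.1)
      =ᶠ[𝓝 p] fun q => coeffFun L n q.1 q.2 := by
  filter_upwards [(isOpen_puncturedSet L).mem_nhds hp] with q hq
  rw [coeffFun_eq_sum L hq]

theorem analyticAt_coeffFun {p : ℂ × ℂ} (hp : p ∈ puncturedSet L) (n : ℕ) :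
    AnalyticAt ℂ (fun q : ℂ × ℂ => coeffFun L n q.1 q.2) p :=
  (analyticAt_coeffSum (fun m => analyticOnNhd_kernelCoeff L m p.1 hp) n).congr
    (eventuallyEq_coeffFun L hp n)

theorem analyticOnNhd_omegaForm (n : ℕ) : AnalyticOnNhd ℂ (omegaForm L n) (puncturedSet L) :=
  fun _ hp => (analyticAt_coeffFun L hp n).smul analyticAt_const

/-- Invariance under the generators extends to the group they generate. It holds for every `p`, so
the induction never has to keep track of the punctured set. -/
theorem omegaForm_add {g : ℂ × ℂ} (hg : g ∈ periodGroup L) (n : ℕ) :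
    g.1 ∈ L.lattice ∧ ∀ p, omegaForm L n (p + g) = omegaForm L n p := by
  induction hg using AddSubgroup.closure_induction with
  | mem x hx =>
    obtain ⟨l, rfl⟩ := hx
    refine ⟨l.2, fun p => ?_⟩
    have h : genFun L (p.1 + l) (p.2 + -eta L l) = genFun L p.1 p.2 := by
      ext w
      rw [← sub_eq_add_neg, genFun_add_coe L l.2]
    simp only [omegaForm, coeffFun, Prod.fst_add, Prod.snd_add, h]
  | zero => exact ⟨L.lattice.zero_mem, fun p => by rw [add_zero]⟩
  | add x y _ _ hx hy =>
    exact ⟨L.lattice.add_mem hx.1 hy.1, fun p => by rw [← add_assoc, hy.2, hx.2]⟩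
  | neg x _ hx =>
    exact ⟨L.lattice.neg_mem hx.1, fun p => by rw [← hx.2 (p + -x), neg_add_cancel_right]⟩

theorem descends_omegaForm (n : ℕ) : Descends L (omegaForm L n) := by
  refine ⟨fun q => omegaForm L n q.out, fun p _ => ?_⟩
  have h : -p + (QuotientAddGroup.mk p : (ℂ × ℂ) ⧸ periodGroup L).out ∈ periodGroup L :=
    QuotientAddGroup.eq.mp (QuotientAddGroup.out_eq' _).symm
  rw [← (omegaForm_add L h n).2 p]
  simp

theorem hasPoleWithResidue_omegaForm {n : ℕ} (hn : 1 ≤ n) :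
    HasPoleWithResidue L (omegaForm L n)
      (Polynomial.C (1 / ((n - 1)! : ℂ)) * Polynomial.X ^ (n - 1)) := by
  refine ⟨fun p => (∑ ij ∈ Finset.HasAntidiagonal.antidiagonal n,
    (-p.2) ^ ij.1 / (ij.1 ! : ℂ) * kernelReg L ij.2 p.1) • dz, fun p hp => ?_, fun p hp => ?_⟩
  · refine (analyticAt_coeffSum (fun m => analyticOnNhd_kernelReg L m p.1 ?_) n).smul
      analyticAt_const
    exact fun h => h.2 (hp h.1)
  · refine Eq.trans ?_ (add_smul _ _ dz)
    rw [omegaForm, coeffFun_eq_sum L hp]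
    congr 1
    simp only [kernelCoeff_eq_add L hp, mul_add, Finset.sum_add_distrib]
    congr 1
    rw [Finset.sum_eq_single (n - 1, 1)]
    · simp
      ring
    · rintro ⟨i, j⟩ hij hne
      rw [Finset.HasAntidiagonal.mem_antidiagonal] at hij
      have : j ≠ 1 := by
        rintro rfl
        exact hne (by ext <;> simp; omega)
      simp [this]
    · intro h
      exact absurd (Finset.HasAntidiagonal.mem_antidiagonal.mpr (by simp; omega)) h

/-- With `t = ζ(z) - s` one has `-dt = ℘ dz + ds`, and the term `-x dx/y = -℘ dz` cancels the first
summand. -/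
theorem nuForm_eq {p : ℂ × ℂ} (hp : p ∈ puncturedSet L) :
    nuForm L p = ContinuousLinearMap.snd ℂ ℂ ℂ := by
  have h1 : HasFDerivAt (fun q : ℂ × ℂ => zeta L q.1 - q.2) _ p :=
    ((hasDerivAt_zeta L hp).hasFDerivAt.comp p hasFDerivAt_fst).sub hasFDerivAt_snd
  have h2 : (fun q : ℂ × ℂ => unif L q 2) = fun q => zeta L q.1 - q.2 := by
    ext q; simp [unif]
  rw [nuForm, h2, h1.fderiv]
  ext <;> simp [unif, dz]

theorem extDeriv_toForm_smul {f : ℂ × ℂ → ℂ} {f' : ℂ × ℂ →L[ℂ] ℂ} {p : ℂ × ℂ}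
    (hf : HasFDerivAt f f' p) (c : ℂ × ℂ →L[ℂ] ℂ) :
    extDeriv (toForm fun q => f q • c) p = wedge f' c := by
  have h : toForm (fun q => f q • c) = fun q => f q •
      ContinuousAlternatingMap.ofSubsingleton ℂ (ℂ × ℂ) ℂ (0 : Fin 1) c := by
    ext q v
    simp [toForm]
  rw [extDeriv, h, wedge]
  have h2 := hf.smul_const (ContinuousAlternatingMap.ofSubsingleton ℂ (ℂ × ℂ) ℂ (0 : Fin 1) c)
  exact congrArg _ h2.fderiv

theorem extDeriv_toForm_congr {θ θ' : OneForm} {p : ℂ × ℂ} (h : θ =ᶠ[𝓝 p] θ') :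
    extDeriv (toForm θ) p = extDeriv (toForm θ') p := by
  have : toForm θ =ᶠ[𝓝 p] toForm θ' := h.mono fun q hq => by simp only [toForm, hq]
  rw [extDeriv, extDeriv, this.fderiv_eq]

theorem extDeriv_toForm_of_eventuallyEq_const {θ : OneForm} {p : ℂ × ℂ} {c : ℂ × ℂ →L[ℂ] ℂ}
    (h : θ =ᶠ[𝓝 p] fun _ => c) : extDeriv (toForm θ) p = 0 := by
  rw [extDeriv_toForm_congr h]
  have : (fun _ : ℂ × ℂ => c) = fun q => (fun _ => (1 : ℂ)) q • c := by simp
  rw [this, extDeriv_toForm_smul (hasFDerivAt_const 1 p)]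
  ext v
  simp [wedge_apply]

theorem extDeriv_nuForm {p : ℂ × ℂ} (hp : p ∈ puncturedSet L) :
    extDeriv (toForm (nuForm L)) p = 0 :=
  extDeriv_toForm_of_eventuallyEq_const
    (((isOpen_puncturedSet L).eventually_mem hp).mono fun _ => nuForm_eq L)

theorem extDeriv_omegaForm_zero {p : ℂ × ℂ} (hp : p ∈ puncturedSet L) :
    extDeriv (toForm (omegaForm L 0)) p = 0 :=
  extDeriv_toForm_of_eventuallyEq_const (c := dz)
    (((isOpen_puncturedSet L).eventually_mem hp).mono fun q hq => by
      rw [omegaForm, coeffFun_zero L hq, one_smul])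

theorem hasDerivAt_coeffFun {z : ℂ} (hz : z ∉ L.lattice) (n : ℕ) (s : ℂ) :
    HasDerivAt (fun s => coeffFun L (n + 1) z s) (-coeffFun L n z s) s := by
  simp only [coeffFun_eq_sum L hz, Finset.Nat.sum_antidiagonal_succ]
  rw [← Finset.sum_neg_distrib]
  simp only [pow_zero]
  -- The summand with exponent `0` of `-s` is independent of `s`; the other summands, shifted by
  -- one, differentiate to those of index `n`.
  refine HasDerivAt.const_add _ (HasDerivAt.fun_sum fun ij _ => ?_)
  convert! (((hasDerivAt_neg s).pow (ij.1 + 1)).div_const ((ij.1 + 1)! : ℂ)).mul_const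
    (kernelCoeff L ij.2 z) using 1
  have := Nat.cast_ne_zero (R := ℂ).mpr ij.1.factorial_ne_zero
  have h2 : ((ij.1 : ℂ) + 1) ≠ 0 := Nat.cast_add_one_ne_zero _
  rw [Nat.factorial_succ]
  push_cast
  field_simp

/-- Only `∂f/∂s` survives in `df ∧ dz`, because `dz ∧ dz = 0`; that derivative is `-f⁽ⁿ⁾`, and `ν =
ds`. -/
theorem extDeriv_omegaForm_succ {p : ℂ × ℂ} (hp : p ∈ puncturedSet L) (n : ℕ) :
    extDeriv (toForm (omegaForm L (n + 1))) p = -wedge (nuForm L p) (omegaForm L n p) := by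
  have hf := (analyticAt_coeffFun L hp (n + 1)).differentiableAt.hasFDerivAt
  have h1 : HasDerivAt (fun s : ℂ => (p.1, s)) ((0, 1) : ℂ × ℂ) p.2 :=
    (hasDerivAt_const p.2 p.1).prodMk (hasDerivAt_id p.2)
  have h2 := (HasFDerivAt.comp_hasDerivAt (l := fun q : ℂ × ℂ => coeffFun L (n + 1) q.1 q.2)
    p.2 hf h1).unique (hasDerivAt_coeffFun L hp n p.2)
  unfold omegaForm
  rw [extDeriv_toForm_smul hf, nuForm_eq L hp]
  set f' := fderiv ℂ (fun q : ℂ × ℂ => coeffFun L (n + 1) q.1 q.2) p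
  have h3 : ∀ v : ℂ × ℂ, f' v = v.1 * f' (1, 0) + v.2 * f' (0, 1) := by
    intro v
    rw [← smul_eq_mul, ← smul_eq_mul, ← map_smul, ← map_smul, ← map_add]
    simp
  ext v
  rw [ContinuousAlternatingMap.neg_apply, wedge_apply, wedge_apply, h3 (v 0), h3 (v 1), h2]
  simp [dz]
  ring

end

section

variable (L : PeriodPair)

/-! ### The differential equation of second order -/

theorem hasDerivAt_weierstrassP {z : ℂ} (hz : z ∉ L.lattice) :
    HasDerivAt L.weierstrassP (L.derivWeierstrassP z) z := by
  rw [← L.deriv_weierstrassP]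
  exact (L.analyticOnNhd_weierstrassP z hz).differentiableAt.hasDerivAt

theorem weierstrassP_eq (z : ℂ) : L.weierstrassP z = 1 / z ^ 2 + L.weierstrassPExcept 0 z := by
  have h2 := L.weierstrassPExcept_add 0 z
  rw [← h2]
  simp
  ring

theorem eventually_notMem : ∀ᶠ z in 𝓝[≠] (0 : ℂ), z ∉ L.lattice := by
  filter_upwards [nhdsWithin_le_nhds (L.isOpen_compl_lattice_sdiff.mem_nhds (zero_mem_compl L)),
    self_mem_nhdsWithin] with z hz h0 h
  exact hz ⟨h, h0⟩

theorem tendsto_sq_mul_weierstrassP :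
    Tendsto (fun z => z ^ 2 * L.weierstrassP z) (𝓝[≠] 0) (𝓝 1) := by
  have h : ContinuousAt (fun z => 1 + z ^ 2 * L.weierstrassPExcept 0 z) 0 :=
    continuousAt_const.add ((continuousAt_id.pow 2).mul
      (L.analyticAt_weierstrassPExcept 0).continuousAt)
  have h' := h.tendsto.mono_left (nhdsWithin_le_nhds (s := {0}ᶜ))
  simp only [ne_eq, OfNat.ofNat_ne_zero, not_false_eq_true, zero_pow, zero_mul, add_zero] at h'
  refine h'.congr' ?_
  filter_upwards [self_mem_nhdsWithin] with z hz
  have hz : z ≠ 0 := hz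
  rw [weierstrassP_eq]
  field_simp

theorem tendsto_inv_weierstrassP :
    Tendsto (fun z => (L.weierstrassP z)⁻¹) (𝓝[≠] 0) (𝓝 0) := by
  have h1 : Tendsto (fun z : ℂ => z ^ 2) (𝓝[≠] 0) (𝓝 0) := by
    have : ContinuousAt (fun z : ℂ => z ^ 2) 0 := by fun_prop
    simpa using this.tendsto.mono_left (nhdsWithin_le_nhds (s := {0}ᶜ))
  have h := h1.mul ((tendsto_sq_mul_weierstrassP L).inv₀ one_ne_zero)
  rw [zero_mul] at h
  refine h.congr' ?_
  filter_upwards [self_mem_nhdsWithin] with z hz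
  have hz : z ≠ 0 := hz
  rw [mul_inv, ← mul_assoc, mul_inv_cancel₀ (pow_ne_zero 2 hz), one_mul]

theorem eventually_weierstrassP_ne_zero : ∀ᶠ z in 𝓝[≠] (0 : ℂ), L.weierstrassP z ≠ 0 := by
  filter_upwards [(tendsto_sq_mul_weierstrassP L).eventually_ne one_ne_zero] with z hz h
  exact hz (by rw [h, mul_zero])

/-- Otherwise `℘` would be constant on the connected complement of the lattice, contradicting its
pole at `0`. -/
theorem exists_derivWeierstrassP_ne_zero : ∃ z ∉ L.lattice, L.derivWeierstrassP z ≠ 0 := by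
  by_contra! h
  set w := L.ω₁ / 2
  have hw : w ∉ L.lattice := L.ω₁_div_two_notMem_lattice
  have hc : ∀ z ∉ L.lattice, L.weierstrassP z = L.weierstrassP w := fun z hz =>
    eq_of_hasDerivAt_zero L (fun z hz => h z hz ▸ hasDerivAt_weierstrassP L hz) hz hw
  have h1 : Tendsto (fun z => (L.weierstrassP z)⁻¹) (𝓝[≠] 0) (𝓝 (L.weierstrassP w)⁻¹) := by
    refine tendsto_const_nhds.congr' ?_
    filter_upwards [eventually_notMem L] with z hz
    rw [hc z hz]
  have h2 := tendsto_nhds_unique h1 (tendsto_inv_weierstrassP L)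
  obtain ⟨z, hz, hz'⟩ := ((eventually_notMem L).and (eventually_weierstrassP_ne_zero L)).exists
  rw [hc z hz] at hz'
  exact hz' (inv_eq_zero.mp h2)

/-- Differentiating the cubic relation gives `℘' · (2℘'' - 12℘² + g₂) = 0`. By the identity theorem
one factor vanishes identically, and it is not `℘'`. -/
theorem hasDerivAt_derivWeierstrassP {z : ℂ} (hz : z ∉ L.lattice) :
    HasDerivAt L.derivWeierstrassP (6 * L.weierstrassP z ^ 2 - L.g₂ / 2) z := by
  have hP := L.analyticOnNhd_weierstrassP
  have hP' := L.analyticOnNhd_derivWeierstrassP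
  have key := AnalyticOnNhd.eq_zero_or_eq_zero_of_mul_eq_zero
    (f := L.derivWeierstrassP)
    (g := fun z => 2 * deriv L.derivWeierstrassP z - 12 * L.weierstrassP z ^ 2 + L.g₂)
    hP' (((analyticOnNhd_const.mul hP'.deriv).sub (analyticOnNhd_const.mul (hP.pow 2))).add
      analyticOnNhd_const) (fun z hz => ?_) (isPreconnected_compl_lattice L)
  · rcases key with h | h
    · obtain ⟨w, hw, hw'⟩ := exists_derivWeierstrassP_ne_zero L
      exact absurd (h w hw) hw'
    · have h1 := h z hz
      have h2 : deriv L.derivWeierstrassP z = 6 * L.weierstrassP z ^ 2 - L.g₂ / 2 := by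
        linear_combination h1 / 2
      rw [← h2]
      exact (hP' z hz).differentiableAt.hasDerivAt
  · have hd := (hP' z hz).differentiableAt.hasDerivAt
    have e1 := hd.pow 2
    have e2 := (((hasDerivAt_weierstrassP L hz).pow 3).const_mul 4).sub
      ((hasDerivAt_weierstrassP L hz).const_mul L.g₂) |>.sub_const L.g₃
    have e3 := (e1.congr_of_eventuallyEq ?_).unique e2
    · simp only [Nat.cast_ofNat, Nat.add_one_sub_one, pow_one] at e3
      linear_combination e3
    · filter_upwards [(isOpen_compl_lattice L).mem_nhds hz] with w hw
      simpa using (L.derivWeierstrassP_sq w hw).symm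

/-! ### The Laurent coefficients of `℘` at the origin -/

/-- Substitute `℘ = 1/z² + p` in `℘'' = 6℘² - g₂/2`: the terms `6/z⁴` cancel, and multiplication by
`z²` clears the remaining pole. -/
theorem taylor_weierstrassPExcept_ode :
    PowerSeries.X ^ 2 * PowerSeries.derivative ℂ (PowerSeries.derivative ℂ
        (taylor (L.weierstrassPExcept 0)))
      = (12 : ℂ) • taylor (L.weierstrassPExcept 0)
        + (6 : ℂ) • (PowerSeries.X ^ 2 * taylor (L.weierstrassPExcept 0) ^ 2)
        - (L.g₂ / 2) • PowerSeries.X ^ 2 := by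
  set p := L.weierstrassPExcept 0 with hp
  have ap : AnalyticAt ℂ p 0 := L.analyticAt_weierstrassPExcept 0
  have ap2 : AnalyticAt ℂ (deriv (deriv p)) 0 := ap.deriv.deriv
  have ai : AnalyticAt ℂ (fun w : ℂ => w) 0 := analyticAt_id
  have ev : (fun w => w * (w * deriv (deriv p) w)) =ᶠ[𝓝 0]
      fun w => 12 * p w + (6 * ((w * w) * (p w * p w)) + (-(L.g₂ / 2)) * (w * w)) := by
    filter_upwards [L.isOpen_compl_lattice_sdiff.mem_nhds (zero_mem_compl L)] with w hw
    rcases eq_or_ne w 0 with rfl | h0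
    · simp [hp]
    have hwL : w ∉ L.lattice := fun h => hw ⟨h, h0⟩
    have hopen := (isOpen_compl_lattice L).mem_nhds hwL
    have e1 : ∀ v ∉ L.lattice, deriv p v = L.derivWeierstrassP v + 2 / v ^ 3 := by
      intro v hv
      have hv0 := ne_zero_of_notMem L hv
      have : HasDerivAt (fun v => L.weierstrassP v - (v ^ 2)⁻¹) _ v :=
        (hasDerivAt_weierstrassP L hv).sub ((hasDerivAt_pow 2 v).inv (pow_ne_zero 2 hv0))
      have e : p = fun v => L.weierstrassP v - (v ^ 2)⁻¹ := by
        ext v; rw [weierstrassP_eq]; ring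
      rw [e, this.deriv]
      field_simp
      push_cast
      ring
    have e2 : deriv (deriv p) w = 6 * L.weierstrassP w ^ 2 - L.g₂ / 2 - 6 / w ^ 4 := by
      have e3 : deriv p =ᶠ[𝓝 w] fun v => L.derivWeierstrassP v + 2 * (v ^ 3)⁻¹ := by
        filter_upwards [hopen] with v hv
        rw [e1 v hv]; ring
      rw [e3.deriv_eq]
      have : HasDerivAt (fun v => L.derivWeierstrassP v + 2 * (v ^ 3)⁻¹) _ w :=
        (hasDerivAt_derivWeierstrassP L hwL).add
          (((hasDerivAt_pow 3 w).inv (pow_ne_zero 3 h0)).const_mul 2)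
      rw [this.deriv]
      field_simp
      push_cast
      ring
    rw [e2, weierstrassP_eq, ← hp]
    field_simp
    ring
  have h := taylor_congr ev
  have aip : AnalyticAt ℂ (fun w => w * deriv (deriv p) w) 0 := ai.mul ap2
  have aii : AnalyticAt ℂ (fun w : ℂ => w * w) 0 := ai.mul ai
  have app : AnalyticAt ℂ (fun w => p w * p w) 0 := ap.mul ap
  have a4 : AnalyticAt ℂ (fun w => w * w * (p w * p w)) 0 := aii.mul app
  have c1 : AnalyticAt ℂ (fun w => 12 * p w) 0 := analyticAt_const.mul ap
  have c2 : AnalyticAt ℂ (fun w => 6 * (w * w * (p w * p w))) 0 := analyticAt_const.mul a4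
  have c3 : AnalyticAt ℂ (fun w => -(L.g₂ / 2) * (w * w)) 0 := analyticAt_const.mul aii
  have c4 : AnalyticAt ℂ (fun w => 6 * (w * w * (p w * p w)) + -(L.g₂ / 2) * (w * w)) 0 :=
    c2.add c3
  rw [taylor_mul ai aip, taylor_mul ai ap2, taylor_deriv, taylor_deriv, taylor_id,
    taylor_add c1 c4, taylor_const_mul _ ap, taylor_add c2 c3, taylor_const_mul _ a4,
    taylor_const_mul _ aii, taylor_mul aii app, taylor_mul ai ai, taylor_mul ap ap,
    taylor_id] at h
  rw [pow_two PowerSeries.X, pow_two (taylor p), mul_assoc PowerSeries.X, h, neg_smul]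
  abel

theorem coeff_taylor_weierstrassPExcept_mem {k : Subfield ℂ} (h₂ : L.g₂ ∈ k) (h₃ : L.g₃ ∈ k)
    (n : ℕ) : PowerSeries.coeff n (taylor (L.weierstrassPExcept 0)) ∈ k := by
  induction n using Nat.strong_induction_on with
  | _ n ih =>
  have ode := taylor_weierstrassPExcept_ode L
  set T := taylor (L.weierstrassPExcept 0) with hT
  match n with
  | 0 => rw [hT, coeff_zero_taylor, PeriodPair.weierstrassPExcept_zero]; exact k.zero_mem
  | 1 =>
    have h := congrArg (PowerSeries.coeff 1) ode
    simp [PowerSeries.coeff_X_pow_mul', PowerSeries.coeff_X_pow] at h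
    rw [h]
    exact k.zero_mem
  | m + 2 =>
    -- In degree `4` the differential equation does not determine the coefficient; it is `5 G₆`, and
    -- this is where `g₃ = 140 G₆` enters.
    by_cases hm : m = 2
    · subst hm
      rw [hT, coeff_taylor, L.iteratedDeriv_weierstrassPExcept_self 0, L.sumInvPow_zero]
      have : ((4 + 1)! : ℂ) * L.G (4 + 2) / (4 ! : ℂ) = L.g₃ / 28 := by
        rw [PeriodPair.g₃, show (4 + 1)! = 120 from rfl, show 4 ! = 24 from rfl]
        push_cast
        ring
      simp only [Nat.reduceAdd, OfNat.ofNat_ne_zero, if_false]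
      simp only [Nat.reduceAdd] at this
      rw [this]
      exact k.div_mem h₃ (ofNat_mem k 28)
    have h := congrArg (PowerSeries.coeff (m + 2)) ode
    simp only [map_sub, map_add, map_smul, smul_eq_mul] at h
    rw [add_comm m 2] at h
    simp only [PowerSeries.coeff_X_pow_mul, PowerSeries.coeff_derivative, add_comm 2 m] at h
    simp only [PowerSeries.coeff_X_pow, Nat.add_eq_right] at h
    -- The factor is `(m + 2)(m + 1) - 12`, the multiplier of the coefficient of degree `m + 2` in
    -- the equation.
    have hne : ((m : ℂ) - 2) * (m + 5) ≠ 0 := by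
      refine mul_ne_zero (sub_ne_zero.mpr (by exact_mod_cast hm)) ?_
      exact_mod_cast Nat.succ_ne_zero (m + 4)
    have h' : PowerSeries.coeff (m + 2) T = (6 * PowerSeries.coeff m (T ^ 2)
        - L.g₂ / 2 * (if m = 0 then 1 else 0)) / (((m : ℂ) - 2) * (m + 5)) := by
      rw [eq_div_iff hne]
      push_cast at h
      linear_combination h
    rw [h']
    refine k.div_mem (k.sub_mem (k.mul_mem (ofNat_mem k 6) ?_) (k.mul_mem
      (k.div_mem h₂ (ofNat_mem k 2)) ?_)) (k.mul_mem (k.sub_mem (natCast_mem k m)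
        (ofNat_mem k 2)) (k.add_mem (natCast_mem k m) (ofNat_mem k 5)))
    · rw [pow_two, PowerSeries.coeff_mul]
      refine k.sum_mem fun ij hij => ?_
      rw [Finset.HasAntidiagonal.mem_antidiagonal] at hij
      exact k.mul_mem (ih _ (by omega)) (ih _ (by omega))
    · split_ifs
      · exact k.one_mem
      · exact k.zero_mem

end

section

variable (L : PeriodPair) (k : Subfield ℂ)

/-! ### Polynomials in `℘` and `℘'` -/

/-- `f` is off the lattice a polynomial in `℘` and `℘'` with coefficients in `k`. -/
def IsPoly (f : ℂ → ℂ) : Prop :=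
  ∃ C : MvPolynomial (Fin 2) k, ∀ z ∉ L.lattice,
    f z = MvPolynomial.aeval ![L.weierstrassP z, L.derivWeierstrassP z] C

variable {L k}

theorem IsPoly.add {f g : ℂ → ℂ} (hf : IsPoly L k f) (hg : IsPoly L k g) :
    IsPoly L k (fun z => f z + g z) := by
  obtain ⟨C, hC⟩ := hf
  obtain ⟨D, hD⟩ := hg
  exact ⟨C + D, fun z hz => by rw [map_add, ← hC z hz, ← hD z hz]⟩

theorem IsPoly.mul {f g : ℂ → ℂ} (hf : IsPoly L k f) (hg : IsPoly L k g) :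
    IsPoly L k (fun z => f z * g z) := by
  obtain ⟨C, hC⟩ := hf
  obtain ⟨D, hD⟩ := hg
  exact ⟨C * D, fun z hz => by rw [map_mul, ← hC z hz, ← hD z hz]⟩

theorem isPoly_const {c : ℂ} (hc : c ∈ k) : IsPoly L k (fun _ => c) :=
  ⟨MvPolynomial.C ⟨c, hc⟩, fun z _ => by rw [MvPolynomial.algHom_C]; rfl⟩

theorem IsPoly.sum {ι : Type*} {f : ι → ℂ → ℂ} (s : Finset ι) (hf : ∀ i ∈ s, IsPoly L k (f i)) :
    IsPoly L k (fun z => ∑ i ∈ s, f i z) := by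
  classical
  induction s using Finset.induction_on with
  | empty => simpa using isPoly_const k.zero_mem
  | insert i s hi ih =>
    simp only [Finset.sum_insert hi]
    exact (hf i (Finset.mem_insert_self i s)).add
      (ih fun j hj => hf j (Finset.mem_insert_of_mem hj))

theorem IsPoly.congr {f g : ℂ → ℂ} (hf : IsPoly L k f) (h : ∀ z ∉ L.lattice, g z = f z) :
    IsPoly L k g := by
  obtain ⟨C, hC⟩ := hf
  exact ⟨C, fun z hz => (h z hz).trans (hC z hz)⟩

theorem isPoly_weierstrassP : IsPoly L k L.weierstrassP :=
  ⟨MvPolynomial.X 0, fun z _ => by simp⟩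

theorem isPoly_derivWeierstrassP : IsPoly L k L.derivWeierstrassP :=
  ⟨MvPolynomial.X 1, fun z _ => by simp⟩

theorem isPoly_deriv_aeval (h₂ : L.g₂ ∈ k) (C : MvPolynomial (Fin 2) k) :
    ∃ g, IsPoly L k g ∧ ∀ z ∉ L.lattice, HasDerivAt
      (fun z => MvPolynomial.aeval ![L.weierstrassP z, L.derivWeierstrassP z] C) (g z) z := by
  induction C using MvPolynomial.induction_on with
  | C c =>
    refine ⟨fun _ => 0, isPoly_const k.zero_mem, fun z _ => ?_⟩
    simp only [MvPolynomial.algHom_C]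
    exact hasDerivAt_const z _
  | add C D hC hD =>
    obtain ⟨g, hg, hg'⟩ := hC
    obtain ⟨h, hh, hh'⟩ := hD
    refine ⟨_, hg.add hh, fun z hz => ?_⟩
    simp only [map_add]
    exact (hg' z hz).add (hh' z hz)
  | mul_X C i hC =>
    obtain ⟨g, hg, hg'⟩ := hC
    obtain ⟨x, x', hx, hx', hxx, e⟩ : ∃ x x' : ℂ → ℂ, IsPoly L k x ∧ IsPoly L k x' ∧
        (∀ z ∉ L.lattice, HasDerivAt x (x' z) z) ∧
        ∀ z, MvPolynomial.aeval ![L.weierstrassP z, L.derivWeierstrassP z]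
          (MvPolynomial.X i : MvPolynomial (Fin 2) k) = x z := by
      fin_cases i
      · exact ⟨_, _, isPoly_weierstrassP, isPoly_derivWeierstrassP,
          fun z => hasDerivAt_weierstrassP L, by simp⟩
      · refine ⟨_, fun z => 6 * (L.weierstrassP z * L.weierstrassP z) + -(L.g₂ / 2),
          isPoly_derivWeierstrassP, ?_, fun z hz => ?_, by simp⟩
        · exact ((isPoly_const (ofNat_mem k 6)).mul (isPoly_weierstrassP.mul
            isPoly_weierstrassP)).add (isPoly_const (k.neg_mem (k.div_mem h₂ (ofNat_mem k 2))))
        · convert! hasDerivAt_derivWeierstrassP L hz using 1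
          ring
    refine ⟨_, (hg.mul hx).add ((show IsPoly L k _ from ⟨C, fun _ _ => rfl⟩).mul hx'),
      fun z hz => ?_⟩
    simp only [map_mul, e]
    exact (hg' z hz).mul (hxx z hz)

theorem IsPoly.deriv (h₂ : L.g₂ ∈ k) {f : ℂ → ℂ} (hf : IsPoly L k f) : IsPoly L k (deriv f) := by
  obtain ⟨C, hC⟩ := hf
  obtain ⟨g, hg, hg'⟩ := isPoly_deriv_aeval h₂ C
  refine hg.congr fun z hz => ?_
  have : f =ᶠ[𝓝 z] fun z => MvPolynomial.aeval ![L.weierstrassP z, L.derivWeierstrassP z] C := by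
    filter_upwards [(isOpen_compl_lattice L).mem_nhds hz] with w hw using hC w hw
  rw [this.deriv_eq, (hg' z hz).deriv]

theorem IsPoly.iteratedDeriv (h₂ : L.g₂ ∈ k) {f : ℂ → ℂ} (hf : IsPoly L k f) (n : ℕ) :
    IsPoly L k (iteratedDeriv n f) := by
  induction n with
  | zero => simpa using hf
  | succ n ih => rw [iteratedDeriv_succ]; exact ih.deriv h₂

/-! ### The Taylor coefficients of `e^{-ζ(z) w} w σ(z + w) / (σ(z) σ(w))` -/

variable (L)

/-- The Taylor coefficients of `e^{-ζ(z) w} w σ(z + w) / (σ(z) σ(w))`. -/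
def twistCoeff (n : ℕ) (z : ℂ) : ℂ :=
  PowerSeries.coeff n (taylor fun w => Complex.exp (-zeta L z * w) * kernel L z w)

theorem coeff_exp_add_mul_kernel (d c z : ℂ) (n : ℕ) :
    PowerSeries.coeff n (taylor fun w => Complex.exp ((d + c) * w) * kernel L z w)
      = ∑ ij ∈ Finset.HasAntidiagonal.antidiagonal n, d ^ ij.1 / (ij.1 ! : ℂ) *
        PowerSeries.coeff ij.2 (taylor fun w => Complex.exp (c * w) * kernel L z w) := by
  have h : (fun w => Complex.exp ((d + c) * w) * kernel L z w)
      = fun w => Complex.exp (d * w) * (Complex.exp (c * w) * kernel L z w) := by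
    ext w
    rw [add_mul, Complex.exp_add, mul_assoc]
  rw [h, taylor_mul (analyticAt_exp_mul d) (analyticAt_exp_mul_kernel L c z), taylor_exp,
    PowerSeries.coeff_mul]
  refine Finset.sum_congr rfl fun ij _ => ?_
  rw [PowerSeries.coeff_rescale, PowerSeries.coeff_exp]
  simp [div_eq_mul_inv]

theorem coeffFun_eq_sum_twistCoeff {z : ℂ} (hz : z ∉ L.lattice) (n : ℕ) (s : ℂ) :
    coeffFun L n z s = ∑ ij ∈ Finset.HasAntidiagonal.antidiagonal n,
      (zeta L z - s) ^ ij.1 / (ij.1 ! : ℂ) * twistCoeff L ij.2 z := by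
  rw [coeffFun_eq_coeff L hz, show -s = (zeta L z - s) + -zeta L z by ring,
    coeff_exp_add_mul_kernel]
  rfl

theorem twistCoeff_zero {z : ℂ} (hz : z ∉ L.lattice) : twistCoeff L 0 z = 1 := by
  rw [twistCoeff, coeff_taylor_exp_mul_kernel]
  simp [kernelCoeff_zero L hz]

/-- The logarithmic derivative in `w` of `e^{-ζ(z) w} w σ(z + w) / (σ(z) σ(w))`. -/
def twistLog (z w : ℂ) : ℂ := (-zeta L z + zeta L (z + w)) + (-1) * zetaExcept L w

theorem analyticAt_zeta {z : ℂ} (hz : z ∉ L.lattice) : AnalyticAt ℂ (zeta L) z :=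
  DifferentiableOn.analyticAt (s := (L.lattice : Set ℂ)ᶜ)
    (fun _ hw => (hasDerivAt_zeta L hw).differentiableAt.differentiableWithinAt)
    ((isOpen_compl_lattice L).mem_nhds hz)

theorem analyticAt_zetaExcept : AnalyticAt ℂ (zetaExcept L) 0 :=
  (differentiableOn_zetaExcept L).analyticAt
    (L.isOpen_compl_lattice_sdiff.mem_nhds (zero_mem_compl L))

theorem analyticAt_twistLog {z : ℂ} (hz : z ∉ L.lattice) : AnalyticAt ℂ (twistLog L z) 0 := by
  have h1 : AnalyticAt ℂ (fun w => zeta L (z + w)) 0 :=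
    AnalyticAt.fun_comp (g := zeta L) (f := fun w => z + w)
      (by rw [add_zero]; exact analyticAt_zeta L hz) (analyticAt_const.add analyticAt_id)
  exact (analyticAt_const.add h1).add (analyticAt_const.mul (analyticAt_zetaExcept L))

theorem eventually_add_notMem {z : ℂ} (hz : z ∉ L.lattice) :
    ∀ᶠ w in 𝓝 (0 : ℂ), z + w ∉ L.lattice := by
  have : ContinuousAt (fun w => z + w) 0 := by fun_prop
  exact this.eventually_mem (by rw [add_zero]; exact (isOpen_compl_lattice L).mem_nhds hz)

/-- The equation `F' = (log F)' F`, read in power series, determines the coefficients of `F`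
recursively from those of `twistLog`. -/
theorem derivative_taylor_twist {z : ℂ} (hz : z ∉ L.lattice) :
    PowerSeries.derivative ℂ (taylor fun w => Complex.exp (-zeta L z * w) * kernel L z w)
      = taylor (twistLog L z) * taylor fun w => Complex.exp (-zeta L z * w) * kernel L z w := by
  rw [← taylor_deriv, ← taylor_mul (analyticAt_twistLog L hz) (analyticAt_exp_mul_kernel L _ z)]
  refine taylor_congr ?_
  filter_upwards [eventually_add_notMem L hz,
    L.isOpen_compl_lattice_sdiff.mem_nhds (zero_mem_compl L)] with w hw hw'
  have h1 : HasDerivAt (fun w => Complex.exp (-zeta L z * w))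
      (Complex.exp (-zeta L z * w) * (-zeta L z * 1)) w :=
    ((hasDerivAt_id w).const_mul _).cexp
  have h2 : HasDerivAt (fun w => sigma L (z + w)) (zeta L (z + w) * sigma L (z + w)) w :=
    (hasDerivAt_sigma L hw).comp_const_add z w
  have h3 := (differentiable_sigmaProd L w).hasDerivAt
  rw [deriv_sigmaProd L hw'] at h3
  have hs := sigma_ne_zero L hz
  have hp := sigmaProd_ne_zero L hw'
  have h4 : HasDerivAt (kernel L z) _ w :=
    h2.div (h3.const_mul (sigma L z)) (mul_ne_zero hs hp)
  rw [(h1.fun_mul h4).deriv, twistLog, kernel]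
  field_simp
  ring

theorem coeff_zero_twistLog (z : ℂ) : PowerSeries.coeff 0 (taylor (twistLog L z)) = 0 := by
  simp [coeff_zero_taylor, twistLog, zetaExcept_zero]

/-- The derivative of `twistLog` in `w` is `-℘(z + w) + (℘(w) - 1/w²)`; the factor `1/(n + 1)`
undoes the differentiation. -/
theorem coeff_succ_twistLog {z : ℂ} (hz : z ∉ L.lattice) (n : ℕ) :
    PowerSeries.coeff (n + 1) (taylor (twistLog L z)) = ((-1) / (n ! : ℂ) *
      iteratedDeriv n L.weierstrassP z + PowerSeries.coeff n (taylor (L.weierstrassPExcept 0)))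
      * (1 / ((n : ℂ) + 1)) := by
  have hd : taylor (deriv (twistLog L z))
      = (-1 : ℂ) • taylor (fun w => L.weierstrassP (z + w)) + taylor (L.weierstrassPExcept 0) := by
    have aP : AnalyticAt ℂ (fun w => L.weierstrassP (z + w)) 0 :=
      AnalyticAt.fun_comp (g := L.weierstrassP) (f := fun w => z + w)
        (by rw [add_zero]; exact L.analyticOnNhd_weierstrassP z hz)
        (analyticAt_const.add analyticAt_id)
    have aP' : AnalyticAt ℂ (fun w => -1 * L.weierstrassP (z + w)) 0 := analyticAt_const.mul aP
    rw [← taylor_const_mul _ aP, ← taylor_add aP' (L.analyticAt_weierstrassPExcept 0)]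
    refine taylor_congr ?_
    filter_upwards [eventually_add_notMem L hz,
      L.isOpen_compl_lattice_sdiff.mem_nhds (zero_mem_compl L)] with w hw hw'
    have h1 : HasDerivAt (twistLog L z) _ w :=
      (((hasDerivAt_zeta L hw).comp_const_add z w).const_add (-zeta L z)).add
        ((hasDerivAt_zetaExcept L hw').const_mul (-1))
    rw [h1.deriv]
    ring
  have h := congrArg (PowerSeries.coeff n) hd
  rw [taylor_deriv, PowerSeries.coeff_derivative, map_add, map_smul, coeff_taylor fun w =>
    L.weierstrassP (z + w), iteratedDeriv_comp_const_add] at h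
  have hn : ((n : ℂ) + 1) ≠ 0 := Nat.cast_add_one_ne_zero n
  rw [mul_one_div, eq_div_iff hn, h]
  simp
  ring

variable {L}

theorem isPoly_coeff_twistLog (h₂ : L.g₂ ∈ k) (h₃ : L.g₃ ∈ k) (n : ℕ) :
    IsPoly L k (fun z => PowerSeries.coeff n (taylor (twistLog L z))) := by
  rcases n with _ | n
  · exact (isPoly_const k.zero_mem).congr fun z _ => coeff_zero_twistLog L z
  · refine IsPoly.congr ?_ fun z hz => coeff_succ_twistLog L hz n
    have hf : ((n ! : ℕ) : ℂ) ∈ k := natCast_mem k _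
    refine (((isPoly_const (k.div_mem (k.neg_mem k.one_mem) hf)).mul
      (isPoly_weierstrassP.iteratedDeriv h₂ n)).add
        (isPoly_const (coeff_taylor_weierstrassPExcept_mem L h₂ h₃ n))).mul (isPoly_const ?_)
    exact k.div_mem k.one_mem (k.add_mem (natCast_mem k n) k.one_mem)

theorem isPoly_twistCoeff (h₂ : L.g₂ ∈ k) (h₃ : L.g₃ ∈ k) (n : ℕ) :
    IsPoly L k (twistCoeff L n) := by
  induction n using Nat.strong_induction_on with
  | _ n ih =>
  rcases n with _ | n
  · exact (isPoly_const k.one_mem).congr fun z hz => twistCoeff_zero L hz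
  · have e : ∀ z ∉ L.lattice, twistCoeff L (n + 1) z =
        (∑ ij ∈ Finset.HasAntidiagonal.antidiagonal n,
          PowerSeries.coeff ij.1 (taylor (twistLog L z)) * twistCoeff L ij.2 z)
          * (1 / ((n : ℂ) + 1)) := by
      intro z hz
      have h := congrArg (PowerSeries.coeff n) (derivative_taylor_twist L hz)
      rw [PowerSeries.coeff_derivative, PowerSeries.coeff_mul] at h
      have hn : ((n : ℂ) + 1) ≠ 0 := Nat.cast_add_one_ne_zero n
      rw [mul_one_div, eq_div_iff hn]
      exact h
    refine IsPoly.congr (IsPoly.mul (IsPoly.sum _ fun ij hij => ?_) (isPoly_const ?_)) e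
    · rw [Finset.HasAntidiagonal.mem_antidiagonal] at hij
      exact (isPoly_coeff_twistLog h₂ h₃ _).mul (ih _ (by omega))
    · exact k.div_mem k.one_mem (k.add_mem (natCast_mem k n) k.one_mem)

/-- The logarithmic derivative vanishes at `w = 0`: the twist by `e^{-ζ(z)w}` removes exactly the
linear term. -/
theorem twistCoeff_one {z : ℂ} (hz : z ∉ L.lattice) : twistCoeff L 1 z = 0 := by
  have h := congrArg (PowerSeries.coeff 0) (derivative_taylor_twist L hz)
  rw [PowerSeries.coeff_derivative, PowerSeries.coeff_mul] at h
  simpa [coeff_zero_twistLog, -PowerSeries.coeff_zero_eq_constantCoeff, twistCoeff] using h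

end

section

variable (L : PeriodPair)

/-! ### Behaviour at the origin -/

/-- The function `(ζ(z) + ℘'(z)/(2℘(z)))/z`, extended to `z = 0`. -/
def zetaShift (z : ℂ) : ℂ :=
  dslope (zetaExcept L) 0 z + (2 * L.weierstrassPExcept 0 z + z * L.derivWeierstrassPExcept 0 z)
    / (2 * (1 + z ^ 2 * L.weierstrassPExcept 0 z))

theorem continuousAt_zetaShift : ContinuousAt (zetaShift L) 0 := by
  refine ContinuousAt.add ?_ (ContinuousAt.div ?_ ?_ (by simp))
  · exact continuousAt_dslope_same.mpr (analyticAt_zetaExcept L).differentiableAt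
  · exact (continuousAt_const.mul (L.analyticAt_weierstrassPExcept 0).continuousAt).add
      (continuousAt_id.mul (L.analyticAt_derivWeierstrassPExcept 0).continuousAt)
  · exact continuousAt_const.mul (continuousAt_const.add ((continuousAt_id.pow 2).mul
      (L.analyticAt_weierstrassPExcept 0).continuousAt))

theorem derivWeierstrassP_eq (z : ℂ) :
    L.derivWeierstrassP z = -2 / z ^ 3 + L.derivWeierstrassPExcept 0 z := by
  have := L.derivWeierstrassPExcept_def 0 z
  simp only [ZeroMemClass.coe_zero, sub_zero] at this
  rw [this]
  ring

/-- The polar parts `1/z` and `-1/z` of the two summands cancel, and the remainder even vanishes at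
`0`. -/
theorem zeta_add_eq {z : ℂ} (hz : z ≠ 0) (hP : L.weierstrassP z ≠ 0) :
    zeta L z + L.derivWeierstrassP z / (2 * L.weierstrassP z) = z * zetaShift L z := by
  rw [zeta_eq, derivWeierstrassP_eq, weierstrassP_eq, zetaShift, dslope_of_ne _ hz,
    slope_def_field, zetaExcept_zero]
  have h : 1 + z ^ 2 * L.weierstrassPExcept 0 z ≠ 0 := by
    intro h
    apply hP
    rw [weierstrassP_eq]
    field_simp
    rw [h, mul_zero]
  have h' : 1 / z ^ 2 + L.weierstrassPExcept 0 z
      = (1 + z ^ 2 * L.weierstrassPExcept 0 z) / z ^ 2 := by field_simp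
  rw [h']
  field_simp
  ring

/-- The Taylor coefficients of `e^{-(ζ(z) + ℘'(z)/(2℘(z))) w} w σ(z + w) / (σ(z) σ(w))`; the
coordinate `ζ(z) - s + ℘'(z)/(2℘(z))` is regular along `z = 0`. -/
def chartCoeff (n : ℕ) (z : ℂ) : ℂ :=
  PowerSeries.coeff n (taylor fun w => Complex.exp
    ((-(L.derivWeierstrassP z / (2 * L.weierstrassP z)) + -zeta L z) * w) * kernel L z w)

theorem chartCoeff_eq_sum (n : ℕ) (z : ℂ) :
    chartCoeff L n z = ∑ ij ∈ Finset.HasAntidiagonal.antidiagonal n,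
      (-(L.derivWeierstrassP z / (2 * L.weierstrassP z))) ^ ij.1 / (ij.1 ! : ℂ) *
        twistCoeff L ij.2 z := by
  rw [chartCoeff, coeff_exp_add_mul_kernel]
  rfl

/-- The exponent is `-z · zetaShift · w`, so each term with `i ≥ 1` carries a factor `z^i` that
absorbs the simple pole of `kernelCoeff 1`. The term `i = 0` has `j = n ≥ 2` and no pole. -/
theorem exists_chartCoeff_continuousAt {n : ℕ} (hn : 2 ≤ n) :
    ∃ E : ℂ → ℂ, ContinuousAt E 0 ∧ ∀ᶠ z in 𝓝[≠] (0 : ℂ), chartCoeff L n z = E z := by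
  have hb : ∀ j, ContinuousAt (kernelReg L j) 0 := fun j =>
    (analyticOnNhd_kernelReg L j 0 (zero_mem_compl L)).continuousAt
  refine ⟨fun z => kernelReg L n z + ∑ ij ∈ Finset.HasAntidiagonal.antidiagonal (n - 1),
    (-zetaShift L z) ^ (ij.1 + 1) / ((ij.1 + 1)! : ℂ) *
      (z ^ ij.1 * (if ij.2 = 1 then 1 else 0) + z ^ (ij.1 + 1) * kernelReg L ij.2 z), ?_, ?_⟩
  · refine (hb n).add (tendsto_finsetSum _ fun ij _ => ContinuousAt.mul ?_ ?_)
    · exact ((continuousAt_zetaShift L).neg.pow _).div_const _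
    · exact ((continuousAt_id.pow _).mul continuousAt_const).add ((continuousAt_id.pow _).mul (hb _))
  · filter_upwards [eventually_notMem L, eventually_weierstrassP_ne_zero L] with z hz hP
    have hz0 := ne_zero_of_notMem L hz
    rw [chartCoeff, ← neg_add, add_comm, zeta_add_eq L hz0 hP, coeff_taylor_exp_mul_kernel]
    obtain ⟨m, rfl⟩ : ∃ m, n = m + 1 := ⟨n - 1, by omega⟩
    rw [Finset.Nat.sum_antidiagonal_succ]
    congr 1
    · rw [kernelCoeff_eq_add L hz, if_neg (by omega)]
      simp
    · refine Finset.sum_congr rfl fun ij _ => ?_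
      rw [kernelCoeff_eq_add L hz]
      field_simp
      ring

variable {L} {k : Subfield ℂ}

/-! ### Degree bounds from the growth at the origin -/

/-- If the degree `d` exceeded `N`, then `p(℘)/℘^d` would tend to `0` at the pole of `℘`; but it
tends to the leading coefficient, as seen from the reversed polynomial at `1/℘`. -/
theorem natDegree_le_of_continuousAt {p : Polynomial k} {N : ℕ} {E : ℂ → ℂ}
    (hE : ContinuousAt E 0) (h : ∀ᶠ z in 𝓝[≠] (0 : ℂ),
      Polynomial.aeval (L.weierstrassP z) p = L.weierstrassP z ^ N * E z) : p.natDegree ≤ N := by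
  by_contra! hN
  have hp : p ≠ 0 := by rintro rfl; simp at hN
  have h1 : Tendsto (fun z => Polynomial.aeval (L.weierstrassP z)⁻¹ p.reverse) (𝓝[≠] 0)
      (𝓝 (Polynomial.aeval (0 : ℂ) p.reverse)) :=
    (p.reverse.continuous_aeval.tendsto 0).comp (tendsto_inv_weierstrassP L)
  have h2 : Tendsto (fun z => (L.weierstrassP z)⁻¹ ^ (p.natDegree - N) * E z) (𝓝[≠] 0) (𝓝 0) := by
    have := ((tendsto_inv_weierstrassP L).pow (p.natDegree - N)).mul
      (hE.tendsto.mono_left (nhdsWithin_le_nhds (s := {0}ᶜ)))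
    rwa [zero_pow (by omega), zero_mul] at this
  have h3 := tendsto_nhds_unique (h1.congr' ?_) h2
  · rw [← Polynomial.coeff_zero_eq_aeval_zero', Polynomial.coeff_zero_reverse] at h3
    simp [hp] at h3
  · filter_upwards [h, eventually_weierstrassP_ne_zero L] with z hz hP
    let _ : Invertible (L.weierstrassP z) := invertibleOfNonzero hP
    have h4 := Polynomial.eval₂_reverse_mul_pow (algebraMap k ℂ) (L.weierstrassP z) p
    rw [invOf_eq_inv, ← Polynomial.aeval_def, ← Polynomial.aeval_def, hz] at h4
    have h5 : L.weierstrassP z ^ p.natDegree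
        = L.weierstrassP z ^ (p.natDegree - N) * L.weierstrassP z ^ N := by
      rw [← pow_add]; congr 1; omega
    have h6 := pow_ne_zero N hP
    have h7 := pow_ne_zero (p.natDegree - N) hP
    rw [h5] at h4
    rw [inv_pow, inv_mul_eq_div, eq_div_iff h7]
    apply mul_right_cancel₀ h6
    linear_combination h4

/-- The cubic polynomial `4x³ - ax - b`. -/
def cubic (a b : k) : Polynomial k :=
  4 * Polynomial.X ^ 3 - Polynomial.C a * Polynomial.X - Polynomial.C b

theorem aeval_cubic (a b : k) {A : Type*} [CommRing A] [Algebra k A] (x : A) :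
    Polynomial.aeval x (cubic a b) = 4 * x ^ 3 - algebraMap k A a * x - algebraMap k A b := by
  simp only [cubic, map_sub, map_mul, map_pow, Polynomial.aeval_X, Polynomial.aeval_C]
  rw [map_ofNat]

/-- The curve equation eliminates `y²`. `P` and `Q` are fixed before `A`, so degree bounds found at
`(℘, ℘')` in `ℂ` apply in the ring of the overlap without any injectivity of evaluation. -/
theorem exists_reduced (a b : k) (q : MvPolynomial (Fin 2) k) : ∃ P Q : Polynomial k,
    ∀ (A : Type) [CommRing A] [Algebra k A] (x y : A), y ^ 2 = Polynomial.aeval x (cubic a b) →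
      MvPolynomial.aeval ![x, y] q = Polynomial.aeval x P + y * Polynomial.aeval x Q := by
  induction q using MvPolynomial.induction_on with
  | C c => exact ⟨Polynomial.C c, 0, fun A _ _ x y _ => by simp⟩
  | add p q hp hq =>
    obtain ⟨P, Q, h⟩ := hp
    obtain ⟨P', Q', h'⟩ := hq
    refine ⟨P + P', Q + Q', fun A _ _ x y hxy => ?_⟩
    rw [map_add, h A x y hxy, h' A x y hxy, map_add, map_add]
    ring
  | mul_X p i hp =>
    obtain ⟨P, Q, h⟩ := hp
    fin_cases i
    · refine ⟨P * Polynomial.X, Q * Polynomial.X, fun A _ _ x y hxy => ?_⟩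
      rw [map_mul, h A x y hxy]
      simp
      ring
    · refine ⟨cubic a b * Q, P, fun A _ _ x y hxy => ?_⟩
      rw [map_mul, h A x y hxy, map_mul, ← hxy]
      simp
      ring

theorem natDegree_cubic (a b : k) : (cubic a b).natDegree = 3 := by
  unfold cubic
  have : (4 : k) ≠ 0 := by norm_num
  rw [show (4 : Polynomial k) = Polynomial.C 4 from rfl]
  compute_degree!

/-- As `℘` is even and `℘'` odd, the even and odd parts under `z ↦ -z` separate `P` from `yQ`. -/
theorem natDegree_le_of_sum_continuousAt {a b : k} (hg₂ : L.g₂ = (a : ℂ)) (hg₃ : L.g₃ = (b : ℂ))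
    {P Q : Polynomial k} {N : ℕ} {E : ℂ → ℂ} (hE : ContinuousAt E 0)
    (h : ∀ᶠ z in 𝓝[≠] (0 : ℂ), Polynomial.aeval (L.weierstrassP z) P + L.derivWeierstrassP z *
      Polynomial.aeval (L.weierstrassP z) Q = L.weierstrassP z ^ N * E z) :
    P.natDegree ≤ N ∧ (Q = 0 ∨ Q.natDegree + 2 ≤ N) := by
  have hneg : Tendsto (fun z : ℂ => -z) (𝓝[≠] 0) (𝓝[≠] 0) := by
    refine tendsto_nhdsWithin_of_tendsto_nhds_of_eventually_within _ ?_ ?_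
    · have : ContinuousAt (fun z : ℂ => -z) 0 := by fun_prop
      simpa using this.tendsto.mono_left (nhdsWithin_le_nhds (s := {0}ᶜ))
    · filter_upwards [self_mem_nhdsWithin] with z hz
      simpa using hz
  have h' := hneg.eventually h
  simp only [L.weierstrassP_neg, L.derivWeierstrassP_neg] at h'
  have hE' : ContinuousAt (fun z => E (-z)) 0 :=
    ContinuousAt.comp (g := E) (f := fun z => -z) (by rwa [neg_zero]) continuousAt_neg
  refine ⟨natDegree_le_of_continuousAt (L := L) (hE.add hE' |>.div_const 2) ?_, ?_⟩
  · filter_upwards [h, h'] with z h1 h2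
    simp only [Pi.add_apply]
    linear_combination (h1 + h2) / 2
  · rw [or_iff_not_imp_left]
    intro hQ
    -- Squaring the odd part gives a polynomial in `℘` alone, with `3 + 2 deg Q ≤ 2N`; by parity
    -- this means `deg Q + 2 ≤ N`.
    have hd := natDegree_le_of_continuousAt (L := L) (p := cubic a b * Q ^ 2) (N := 2 * N)
      (((hE.sub hE').div_const 2).pow 2) ?_
    · have hc : cubic a b ≠ 0 := by
        intro h0
        have := natDegree_cubic a b
        rw [h0] at this
        simp at this
      rw [Polynomial.natDegree_mul hc (pow_ne_zero 2 hQ), natDegree_cubic,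
        Polynomial.natDegree_pow] at hd
      omega
    · filter_upwards [h, h', eventually_notMem L] with z h1 h2 hz
      have ode := L.derivWeierstrassP_sq z hz
      have hc : Polynomial.aeval (L.weierstrassP z) (cubic a b) = L.derivWeierstrassP z ^ 2 := by
        rw [ode, hg₂, hg₃, aeval_cubic]
        rfl
      have h3 : L.derivWeierstrassP z * Polynomial.aeval (L.weierstrassP z) Q
          = L.weierstrassP z ^ N * ((E z - E (-z)) / 2) := by
        linear_combination (h1 - h2) / 2
      rw [map_mul, hc, map_pow, ← mul_pow, h3, mul_pow, ← pow_mul, mul_comm N]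
      rfl

/-- The function `chartCoeff` on the curve, multiplied by `x ^ n`, where `C j` is the polynomial
which represents `twistCoeff j`. -/
def chartPoly {K : Type*} [Field K] (C : ℕ → MvPolynomial (Fin 2) K) (n : ℕ) :
    MvPolynomial (Fin 2) K :=
  ∑ ij ∈ Finset.HasAntidiagonal.antidiagonal n, MvPolynomial.C ((-(2⁻¹)) ^ ij.1 / (ij.1 ! : K)) *
    MvPolynomial.X 1 ^ ij.1 * MvPolynomial.X 0 ^ ij.2 * C ij.2

theorem aeval_chartPoly {C : ℕ → MvPolynomial (Fin 2) k}
    (hC : ∀ n, ∀ z ∉ L.lattice, twistCoeff L n z =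
      MvPolynomial.aeval ![L.weierstrassP z, L.derivWeierstrassP z] (C n))
    (n : ℕ) {z : ℂ} (hz : z ∉ L.lattice) (hP : L.weierstrassP z ≠ 0) :
    MvPolynomial.aeval ![L.weierstrassP z, L.derivWeierstrassP z] (chartPoly C n)
      = L.weierstrassP z ^ n * chartCoeff L n z := by
  rw [chartPoly, map_sum, chartCoeff_eq_sum, Finset.mul_sum]
  refine Finset.sum_congr rfl fun ij hij => ?_
  rw [Finset.HasAntidiagonal.mem_antidiagonal] at hij
  rw [map_mul, ← hC _ z hz, ← hij, pow_add]
  have : algebraMap k ℂ ((-(2⁻¹)) ^ ij.1 / (ij.1 ! : k)) = (-(2⁻¹)) ^ ij.1 / (ij.1 ! : ℂ) := by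
    simp [map_ofNat]
  simp only [map_mul, MvPolynomial.algHom_C, map_pow, MvPolynomial.aeval_X, this,
    Matrix.cons_val_zero, Matrix.cons_val_one]
  have h2 : -(L.derivWeierstrassP z / (2 * L.weierstrassP z))
      = (-(2⁻¹)) * L.derivWeierstrassP z / L.weierstrassP z := by field_simp
  rw [h2, div_pow, mul_pow]
  field_simp

theorem exists_reduced_chartPoly {a b : k} (hg₂ : L.g₂ = (a : ℂ)) (hg₃ : L.g₃ = (b : ℂ))
    {C : ℕ → MvPolynomial (Fin 2) k}
    (hC : ∀ n, ∀ z ∉ L.lattice, twistCoeff L n z =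
      MvPolynomial.aeval ![L.weierstrassP z, L.derivWeierstrassP z] (C n))
    {n : ℕ} (hn : 2 ≤ n) : ∃ P Q : Polynomial k,
      P.natDegree ≤ n ∧ (Q = 0 ∨ Q.natDegree + 2 ≤ n) ∧
      ∀ (A : Type) [CommRing A] [Algebra k A] (x y : A), y ^ 2 = Polynomial.aeval x (cubic a b) →
        MvPolynomial.aeval ![x, y] (chartPoly C n)
          = Polynomial.aeval x P + y * Polynomial.aeval x Q := by
  obtain ⟨P, Q, h⟩ := exists_reduced a b (chartPoly C n)
  obtain ⟨E, hE, hE'⟩ := exists_chartCoeff_continuousAt L hn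
  have hd := natDegree_le_of_sum_continuousAt hg₂ hg₃ (P := P) (Q := Q) (N := n) hE ?_
  · exact ⟨P, Q, hd.1, hd.2, h⟩
  · filter_upwards [hE', eventually_notMem L, eventually_weierstrassP_ne_zero L] with z h1 hz hP
    have ode := L.derivWeierstrassP_sq z hz
    rw [← h1, ← aeval_chartPoly hC n hz hP, h ℂ]
    rw [ode, hg₂, hg₃, aeval_cubic]
    rfl

end

section

/-! ### Identities in commutative algebras -/

section CommAlgebra

variable {K : Type*} [Field K] {A : Type*} [CommRing A] [Algebra K A]

/-- These are the coefficients of `e^{(s+d)w} c(w) = e^{sw} (e^{dw} c(w))` in the power series ring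
over `A`. -/
theorem sum_exp_add_mul [CharZero K] (c : ℕ → A) (s d : A) (n : ℕ) :
    ∑ ij ∈ Finset.HasAntidiagonal.antidiagonal n, (1 / (ij.1 ! : K)) • ((s + d) ^ ij.1 * c ij.2)
      = ∑ ij ∈ Finset.HasAntidiagonal.antidiagonal n, (1 / (ij.1 ! : K)) • (s ^ ij.1 *
        ∑ pq ∈ Finset.HasAntidiagonal.antidiagonal ij.2, (1 / (pq.1 ! : K)) •
          (d ^ pq.1 * c pq.2)) := by
  -- The formal exponential series requires a `ℚ`-algebra; the structure is taken through `K` so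
  -- that the factorials agree.
  let _ : Algebra ℚ A := Algebra.compHom A (algebraMap ℚ K)
  have key : ∀ (r : A) (f : PowerSeries A) (m : ℕ),
      PowerSeries.coeff m (PowerSeries.rescale r (PowerSeries.exp A) * f)
        = ∑ ij ∈ Finset.HasAntidiagonal.antidiagonal m,
          (1 / (ij.1 ! : K)) • (r ^ ij.1 * PowerSeries.coeff ij.2 f) := by
    intro r f m
    rw [PowerSeries.coeff_mul]
    refine Finset.sum_congr rfl fun ij _ => ?_
    have e : algebraMap ℚ A (1 / (ij.1 ! : ℚ)) = algebraMap K A (1 / (ij.1 ! : K)) := by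
      have : algebraMap ℚ A (1 / (ij.1 ! : ℚ)) = algebraMap K A (algebraMap ℚ K _) := rfl
      rw [this]
      simp
    rw [PowerSeries.coeff_rescale, PowerSeries.coeff_exp, e, Algebra.smul_def]
    ring
  have h := key (s + d) (PowerSeries.mk c) n
  rw [← PowerSeries.exp_mul_exp_eq_exp_add, mul_assoc, key] at h
  simp only [key, PowerSeries.coeff_mk] at h
  exact h.symm

/-- With `u = x/y` and `e = x³/y²` one has `de/e - 2 du/u = dx/x`; multiply by `u`. The curve
equation plays no role. -/
theorem inv_smul_D_eq {x y ix iy : A} (hx : x * ix = 1) (hy : y * iy = 1) :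
    iy • KaehlerDifferential.D K A x = (-2 : A) • KaehlerDifferential.D K A (x * iy)
      + (x * iy * (y ^ 2 * ix ^ 3)) • KaehlerDifferential.D K A (x ^ 3 * iy ^ 2) := by
  simp only [Derivation.leibniz, Derivation.leibniz_pow, smul_add, smul_smul]
  rw [← Nat.cast_smul_eq_nsmul A, ← Nat.cast_smul_eq_nsmul A]
  simp only [smul_smul]
  set X := KaehlerDifferential.D K A x
  set Y := KaehlerDifferential.D K A iy
  have h1 : x * iy * (y ^ 2 * ix ^ 3) * x ^ 3 * ((2 : ℕ) : A) * iy ^ (2 - 1) = 2 * x := by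
    have : x * iy * (y ^ 2 * ix ^ 3) * x ^ 3 * ((2 : ℕ) : A) * iy ^ (2 - 1)
      = 2 * x * (x * ix) ^ 3 * (y * iy) ^ 2 := by push_cast; ring
    rw [this, hx, hy]; ring
  have h2 : x * iy * (y ^ 2 * ix ^ 3) * iy ^ 2 * ((3 : ℕ) : A) * x ^ (3 - 1) = 3 * iy := by
    have : x * iy * (y ^ 2 * ix ^ 3) * iy ^ 2 * ((3 : ℕ) : A) * x ^ (3 - 1)
      = 3 * iy * (x * ix) ^ 3 * (y * iy) ^ 2 := by push_cast; ring
    rw [this, hx, hy]; ring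
  simp only [mul_assoc] at h1 h2 ⊢
  rw [h1, h2]
  module

/-- From `2y dy = (12x² - a) dx`, the left side is `(V y² + U (12x² - a)) dx/y`, whose coefficient
is `1` by the Bézout identity. Hence `dx/y` is regular also where `y = 0`. -/
theorem smul_D_of_cubic {x y : A} {a b U V : A} (ha : KaehlerDifferential.D K A a = 0)
    (hb : KaehlerDifferential.D K A b = 0) (h : y ^ 2 = 4 * x ^ 3 - a * x - b)
    (hUV : V * (4 * x ^ 3 - a * x - b) + U * (12 * x ^ 2 - a) = 1) {iy : A} (hy : y * iy = 1) :
    (V * y) • KaehlerDifferential.D K A x + (2 * U) • KaehlerDifferential.D K A y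
      = iy • KaehlerDifferential.D K A x := by
  have h4 : KaehlerDifferential.D K A (4 : A) = 0 := by
    simpa using (KaehlerDifferential.D K A).map_natCast 4
  have hd := congrArg (KaehlerDifferential.D K A) h
  simp only [map_sub, Derivation.leibniz, Derivation.leibniz_pow, ha, hb, h4,
    smul_zero, add_zero, sub_zero] at hd
  rw [← Nat.cast_smul_eq_nsmul A, ← Nat.cast_smul_eq_nsmul A] at hd
  simp only [smul_smul] at hd
  set X := KaehlerDifferential.D K A x
  set Y := KaehlerDifferential.D K A y
  have e1 : (2 * U) • Y = (iy * U) • ((((2 : ℕ) : A) * y ^ (2 - 1)) • Y) := by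
    rw [smul_smul]
    congr 1
    push_cast
    linear_combination (-2 * U) * hy
  have e2 : V * y = iy * (V * (4 * x ^ 3 - a * x - b)) := by
    rw [← h]
    linear_combination (-V * y) * hy
  rw [e1, hd, e2, ← sub_smul, smul_smul, ← add_smul]
  congr 1
  push_cast
  linear_combination iy * hUV

theorem neg_smul_add_sub_smul {M : Type*} [AddCommGroup M] [Module A M] {c u v : A}
    (hc : c * 2 = 1) (hvu : v * u = 1) (e : A) (X Y : M) :
    (-(c * v)) • ((-2 : A) • X + (u * e) • Y) - v • X = (-(c * e)) • Y := by
  have e2 : -(c * v) * (-2) = v := by linear_combination v * hc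
  have e3 : -(c * v) * (u * e) = -(c * e) := by linear_combination (-(c * e)) * hvu
  rw [smul_add, smul_smul, smul_smul, e2, e3]
  abel

end CommAlgebra

/-! ### The charts of the universal vectorial extension -/

section Charts

variable {K : Type} [Field K] {a b : K}

theorem coord_cubic : coord K a b 1 ^ 2
    = 4 * coord K a b 0 ^ 3 - algebraMap K (Chart K a b) a * coord K a b 0
      - algebraMap K (Chart K a b) b := by
  have h : (Ideal.Quotient.mk _ (MvPolynomial.X 1 ^ 2 - 4 * MvPolynomial.X 0 ^ 3
      + MvPolynomial.C a * MvPolynomial.X 0 + MvPolynomial.C b : MvPolynomial (Fin 3) K) :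
        Chart K a b) = 0 :=
    Ideal.Quotient.eq_zero_iff_mem.mpr (Ideal.subset_span rfl)
  simp only [map_add, map_sub, map_mul, map_pow, map_ofNat] at h
  change coord K a b 1 ^ 2 - 4 * coord K a b 0 ^ 3
    + algebraMap K (Chart K a b) a * coord K a b 0 + algebraMap K (Chart K a b) b = 0 at h
  linear_combination h

theorem ocoord_cubic : ocoord K a b 1 ^ 2
    = 4 * ocoord K a b 0 ^ 3 - algebraMap K (Overlap K a b) a * ocoord K a b 0
      - algebraMap K (Overlap K a b) b := by
  have h := congrArg (algebraMap (Chart K a b) (Overlap K a b)) (coord_cubic (a := a) (b := b))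
  simp only [map_sub, map_mul, map_pow, map_ofNat, ← IsScalarTower.algebraMap_apply] at h
  exact h

theorem ocoord_mul_invXY : ocoord K a b 0 * ocoord K a b 1 * invXY K a b = 1 := by
  have := IsLocalization.Away.mul_invSelf (S := Overlap K a b) (coord K a b 0 * coord K a b 1)
  rwa [map_mul] at this

theorem ocoord_mul_invX : ocoord K a b 0 * invX K a b = 1 := by
  rw [invX, ← mul_assoc, ocoord_mul_invXY]

theorem ocoord_mul_invY : ocoord K a b 1 * invY K a b = 1 := by
  rw [invY, ← mul_assoc, mul_comm (ocoord K a b 1), ocoord_mul_invXY]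

theorem locU_mem : locU K a b ∈ chartAtD K a b := Algebra.subset_adjoin (by simp)

theorem locT_mem : locT K a b ∈ chartAtD K a b := Algebra.subset_adjoin (by simp)

theorem locE_mem : ocoord K a b 0 ^ 3 * invY K a b ^ 2 ∈ chartAtD K a b :=
  Algebra.subset_adjoin (by simp)

theorem locE_inv_mem : ocoord K a b 1 ^ 2 * invX K a b ^ 3 ∈ chartAtD K a b :=
  Algebra.subset_adjoin (by simp)

/-- In terms of the generators, `1/x = u² e⁻¹`; likewise `y/x² = u e⁻¹` below. -/
theorem invX_mem : invX K a b ∈ chartAtD K a b := by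
  have h : invX K a b = locU K a b ^ 2 * (ocoord K a b 1 ^ 2 * invX K a b ^ 3) := by
    rw [locU]
    have hx := ocoord_mul_invX (a := a) (b := b)
    have hy := ocoord_mul_invY (a := a) (b := b)
    have e : (ocoord K a b 0 * invY K a b) ^ 2 * (ocoord K a b 1 ^ 2 * invX K a b ^ 3)
      = (ocoord K a b 0 * invX K a b) ^ 2 * (ocoord K a b 1 * invY K a b) ^ 2 * invX K a b := by
        ring
    rw [e, hx, hy]
    ring
  rw [h]
  exact mul_mem (pow_mem locU_mem 2) locE_inv_mem

theorem ocoord_mul_invX_sq_mem : ocoord K a b 1 * invX K a b ^ 2 ∈ chartAtD K a b := by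
  have h : ocoord K a b 1 * invX K a b ^ 2
      = locU K a b * (ocoord K a b 1 ^ 2 * invX K a b ^ 3) := by
    rw [locU]
    have e : ocoord K a b 0 * invY K a b * (ocoord K a b 1 ^ 2 * invX K a b ^ 3)
      = (ocoord K a b 0 * invX K a b) * (ocoord K a b 1 * invY K a b) *
        (ocoord K a b 1 * invX K a b ^ 2) := by ring
    rw [e, ocoord_mul_invX, ocoord_mul_invY]
    ring
  rw [h]
  exact mul_mem locU_mem locE_inv_mem

theorem invX_pow_mul_aeval_mem {P : Polynomial K} {n : ℕ} (hP : P.natDegree ≤ n) :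
    invX K a b ^ n * Polynomial.aeval (ocoord K a b 0) P ∈ chartAtD K a b := by
  rw [Polynomial.aeval_eq_sum_range, Finset.mul_sum]
  refine sum_mem fun i hi => ?_
  have hi' : i ≤ n := (Nat.lt_succ_iff.mp (Finset.mem_range.mp hi)).trans hP
  have e : invX K a b ^ n * ocoord K a b 0 ^ i = invX K a b ^ (n - i) := by
    obtain ⟨m, rfl⟩ := Nat.exists_eq_add_of_le hi'
    rw [Nat.add_sub_cancel_left, pow_add, mul_right_comm, ← mul_pow, mul_comm (invX K a b),
      ocoord_mul_invX, one_pow, one_mul]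
  rw [mul_smul_comm, e]
  exact Subalgebra.smul_mem _ (pow_mem invX_mem _) _

/-- The bounds are exactly what lets each monomial be written in `1/x` and `y/x²`: a factor `y` uses
up two powers of `1/x`. -/
theorem invX_pow_mul_reduced_mem {P Q : Polynomial K} {n : ℕ} (hP : P.natDegree ≤ n)
    (hQ : Q = 0 ∨ Q.natDegree + 2 ≤ n) :
    invX K a b ^ n * (Polynomial.aeval (ocoord K a b 0) P
      + ocoord K a b 1 * Polynomial.aeval (ocoord K a b 0) Q) ∈ chartAtD K a b := by
  rw [mul_add]
  refine add_mem (invX_pow_mul_aeval_mem hP) ?_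
  rcases hQ with rfl | hQ
  · simp [zero_mem]
  · obtain ⟨m, rfl⟩ := Nat.exists_eq_add_of_le' (show 2 ≤ n by omega)
    have e : invX K a b ^ (m + 2) * (ocoord K a b 1 * Polynomial.aeval (ocoord K a b 0) Q)
      = ocoord K a b 1 * invX K a b ^ 2 *
        (invX K a b ^ m * Polynomial.aeval (ocoord K a b 0) Q) := by ring
    rw [e]
    exact mul_mem ocoord_mul_invX_sq_mem (invX_pow_mul_aeval_mem (by omega))

/-! ### The form `dx/y` -/

theorem D_mem_regularAtD {f : Overlap K a b} (hf : f ∈ chartAtD K a b) :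
    KaehlerDifferential.D K (Overlap K a b) f ∈ regularAtD K a b :=
  Submodule.subset_span ⟨f, hf, rfl⟩

theorem smul_mem_regularAtD {f : Overlap K a b} (hf : f ∈ chartAtD K a b) {θ : OverlapForm K a b}
    (hθ : θ ∈ regularAtD K a b) : f • θ ∈ regularAtD K a b :=
  (regularAtD K a b).smul_mem (⟨f, hf⟩ : chartAtD K a b) hθ

/-- The form `dx/y` on the intersection of the charts. -/
def invariantForm (K : Type) [Field K] (a b : K) : OverlapForm K a b :=
  invY K a b • KaehlerDifferential.D K (Overlap K a b) (ocoord K a b 0)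

theorem invariantForm_eq : invariantForm K a b
    = (-2 : Overlap K a b) • KaehlerDifferential.D K (Overlap K a b) (locU K a b)
      + (locU K a b * (ocoord K a b 1 ^ 2 * invX K a b ^ 3)) •
        KaehlerDifferential.D K (Overlap K a b) (ocoord K a b 0 ^ 3 * invY K a b ^ 2) :=
  inv_smul_D_eq ocoord_mul_invX ocoord_mul_invY

theorem invariantForm_mem : invariantForm K a b ∈ regularAtD K a b := by
  rw [invariantForm_eq]
  refine add_mem (smul_mem_regularAtD ?_ (D_mem_regularAtD locU_mem))
    (smul_mem_regularAtD (mul_mem locU_mem locE_inv_mem) (D_mem_regularAtD locE_mem))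
  exact neg_mem (ofNat_mem _ 2)

/-- Since `dx/y = -2 du + u e⁻¹ de` and `y/x = 1/u`, the form `-(y/(2x)) dx/y` equals `du/u - ½ e⁻¹
de`, and `e` is a unit of the chart. -/
theorem smul_invariantForm_sub_dlogU_mem [CharZero K] :
    (-((2⁻¹ : K) • (ocoord K a b 1 * invX K a b))) • invariantForm K a b - dlogU K a b
      ∈ regularAtD K a b := by
  have h : (-((2⁻¹ : K) • (ocoord K a b 1 * invX K a b))) • invariantForm K a b - dlogU K a b
      = (-((2⁻¹ : K) • (ocoord K a b 1 ^ 2 * invX K a b ^ 3))) •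
        KaehlerDifferential.D K (Overlap K a b) (ocoord K a b 0 ^ 3 * invY K a b ^ 2) := by
    have hx := ocoord_mul_invX (a := a) (b := b)
    have hy := ocoord_mul_invY (a := a) (b := b)
    have h2 : algebraMap K (Overlap K a b) 2⁻¹ * 2 = 1 := by
      rw [← map_ofNat (algebraMap K (Overlap K a b)) 2, ← map_mul, inv_mul_cancel₀ two_ne_zero,
        map_one]
    have e1 : ocoord K a b 1 * invX K a b * locU K a b = 1 := by
      rw [locU]
      linear_combination (ocoord K a b 0 * invX K a b) * hy + hx
    rw [invariantForm_eq, dlogU, Algebra.smul_def, Algebra.smul_def]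
    exact neg_smul_add_sub_smul h2 e1 _ _ _
  rw [h]
  exact smul_mem_regularAtD (neg_mem (Subalgebra.smul_mem _ locE_inv_mem _))
    (D_mem_regularAtD locE_mem)

end Charts

end

section

/-! ### The algebraic forms -/

theorem mul_smul_add_zero_smul {A M : Type*} [CommRing A] [AddCommGroup M] [Module A M]
    (c r s : A) (X Y Z : M) :
    (c * r) • X + (c * s) • Y + (0 : A) • Z = c • (r • X + s • Y) := by
  module

section AlgForms

variable {K : Type} [Field K] (a b : K)

/-- The cofactor of `4x³ - ax - b` in the Bézout identity with its derivative `12x² - a`. -/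
def bezoutV : MvPolynomial (Fin 3) K :=
  MvPolynomial.C (-18 * a / (a ^ 3 - 27 * b ^ 2)) * MvPolynomial.X 0
    + MvPolynomial.C (27 * b / (a ^ 3 - 27 * b ^ 2))

/-- The cofactor of `12x² - a` in the Bézout identity with `4x³ - ax - b`. -/
def bezoutU : MvPolynomial (Fin 3) K :=
  MvPolynomial.C (6 * a / (a ^ 3 - 27 * b ^ 2)) * MvPolynomial.X 0 ^ 2
    + MvPolynomial.C (-9 * b / (a ^ 3 - 27 * b ^ 2)) * MvPolynomial.X 0
    + MvPolynomial.C (-a ^ 2 / (a ^ 3 - 27 * b ^ 2))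

variable {a b}

theorem bezout (hab : a ^ 3 - 27 * b ^ 2 ≠ 0) {A : Type*} [CommRing A] [Algebra K A]
    (v : Fin 3 → A) :
    MvPolynomial.aeval v (bezoutV a b) *
        (4 * v 0 ^ 3 - algebraMap K A a * v 0 - algebraMap K A b)
      + MvPolynomial.aeval v (bezoutU a b) * (12 * v 0 ^ 2 - algebraMap K A a) = 1 := by
  set d := a ^ 3 - 27 * b ^ 2 with hd
  have hdi : algebraMap K A d⁻¹ * (algebraMap K A a ^ 3 - 27 * algebraMap K A b ^ 2) = 1 := by
    have : algebraMap K A a ^ 3 - 27 * algebraMap K A b ^ 2 = algebraMap K A d := by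
      rw [hd, map_sub, map_mul, map_pow, map_pow, map_ofNat]
    rw [this, ← map_mul, inv_mul_cancel₀ hab, map_one]
  simp only [bezoutV, bezoutU, map_add, map_mul, map_pow, MvPolynomial.aeval_X,
    MvPolynomial.algHom_C, div_eq_mul_inv, map_neg, map_ofNat, ← hd]
  linear_combination hdi

variable (a b) in
/-- The coefficients of the form `F dx/y` with respect to `dx`, `dy`, `dt`. -/
def formCoeff (F : MvPolynomial (Fin 3) K) : Fin 3 → MvPolynomial (Fin 3) K :=
  ![F * (bezoutV a b * MvPolynomial.X 1), F * (2 * bezoutU a b), 0]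

variable (a b) in
/-- The form `F dx/y` on the complement of `D`. -/
def polyForm (F : MvPolynomial (Fin 3) K) : AlgForm K a b :=
  ∑ i, ((Ideal.Quotient.mk _ (formCoeff a b F i) : Chart K a b)) •
    KaehlerDifferential.D K (Chart K a b) (coord K a b i)

theorem algebraMap_mk (F : MvPolynomial (Fin 3) K) :
    algebraMap (Chart K a b) (Overlap K a b) (Ideal.Quotient.mk _ F)
      = MvPolynomial.aeval (ocoord K a b) F := by
  induction F using MvPolynomial.induction_on with
  | C c =>
    rw [MvPolynomial.algHom_C]
    exact (IsScalarTower.algebraMap_apply K (Chart K a b) (Overlap K a b) c).symm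
  | add F G hF hG => rw [map_add, map_add, hF, hG, map_add]
  | mul_X F i hF =>
    rw [map_mul, map_mul, hF, map_mul, MvPolynomial.aeval_X]
    rfl

theorem restrictForm_smul_D (c f : Chart K a b) :
    restrictForm K a b (c • KaehlerDifferential.D K (Chart K a b) f)
      = algebraMap (Chart K a b) (Overlap K a b) c •
        KaehlerDifferential.D K (Overlap K a b) (algebraMap (Chart K a b) (Overlap K a b) f) := by
  rw [restrictForm, LinearMap.restrictScalars_apply, map_smul, KaehlerDifferential.map_D,
    algebraMap_smul]

theorem restrictForm_polyForm (hab : a ^ 3 - 27 * b ^ 2 ≠ 0) (F : MvPolynomial (Fin 3) K) :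
    restrictForm K a b (polyForm a b F)
      = MvPolynomial.aeval (ocoord K a b) F • invariantForm K a b := by
  have h := smul_D_of_cubic ((KaehlerDifferential.D K (Overlap K a b)).map_algebraMap a)
    ((KaehlerDifferential.D K (Overlap K a b)).map_algebraMap b) ocoord_cubic
    (bezout hab (ocoord K a b)) (ocoord_mul_invY (a := a) (b := b))
  rw [polyForm, map_sum, Fin.sum_univ_three, restrictForm_smul_D, restrictForm_smul_D,
    restrictForm_smul_D, algebraMap_mk, algebraMap_mk, algebraMap_mk]
  change MvPolynomial.aeval (ocoord K a b) (F * (bezoutV a b * MvPolynomial.X 1)) •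
      KaehlerDifferential.D K (Overlap K a b) (ocoord K a b 0)
    + MvPolynomial.aeval (ocoord K a b) (F * (2 * bezoutU a b)) •
      KaehlerDifferential.D K (Overlap K a b) (ocoord K a b 1)
    + MvPolynomial.aeval (ocoord K a b) 0 •
      KaehlerDifferential.D K (Overlap K a b) (ocoord K a b 2) = _
  have e1 : MvPolynomial.aeval (ocoord K a b) (F * (bezoutV a b * MvPolynomial.X 1))
      = MvPolynomial.aeval (ocoord K a b) F *
        (MvPolynomial.aeval (ocoord K a b) (bezoutV a b) * ocoord K a b 1) := by
    rw [map_mul, map_mul, MvPolynomial.aeval_X]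
  have e2 : MvPolynomial.aeval (ocoord K a b) (F * (2 * bezoutU a b))
      = MvPolynomial.aeval (ocoord K a b) F *
        (2 * MvPolynomial.aeval (ocoord K a b) (bezoutU a b)) := by
    rw [map_mul, map_mul, map_ofNat]
  have e3 : MvPolynomial.aeval (ocoord K a b) (0 : MvPolynomial (Fin 3) K) = 0 := map_zero _
  rw [e1, e2, e3, invariantForm, ← h]
  exact mul_smul_add_zero_smul _ _ _ _ _ _

/-- The coefficient of `w ^ n` in `e^{tw} ∑ C j w ^ j`. -/
def expPoly (C : ℕ → MvPolynomial (Fin 2) K) (n : ℕ) : MvPolynomial (Fin 3) K :=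
  ∑ ij ∈ Finset.HasAntidiagonal.antidiagonal n, (1 / (ij.1 ! : K)) •
    (MvPolynomial.X 2 ^ ij.1 * MvPolynomial.rename Fin.castSucc (C ij.2))

theorem aeval_expPoly (C : ℕ → MvPolynomial (Fin 2) K) (n : ℕ) {A : Type*} [CommRing A]
    [Algebra K A] (v : Fin 3 → A) :
    MvPolynomial.aeval v (expPoly C n) = ∑ ij ∈ Finset.HasAntidiagonal.antidiagonal n,
      (1 / (ij.1 ! : K)) • (v 2 ^ ij.1 * MvPolynomial.aeval ![v 0, v 1] (C ij.2)) := by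
  have hv : v ∘ Fin.castSucc = ![v 0, v 1] := by
    ext i; fin_cases i <;> rfl
  rw [expPoly, map_sum]
  refine Finset.sum_congr rfl fun ij _ => ?_
  rw [map_smul, map_mul, map_pow, MvPolynomial.aeval_X, MvPolynomial.aeval_rename, hv]

theorem mem_logForms_of_hasAlgResidue {α : AlgForm K a b}
    {r : Polynomial K} (h : HasAlgResidue K a b α r) : α ∈ logForms K a b := by
  have hr : Polynomial.aeval (locT K a b) r ∈ chartAtD K a b := by
    rw [Polynomial.aeval_eq_sum_range]
    exact sum_mem fun i _ => Subalgebra.smul_mem _ (pow_mem locT_mem i) _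
  change restrictForm K a b α ∈ logAtD K a b
  rw [← sub_add_cancel (restrictForm K a b α) (Polynomial.aeval (locT K a b) r • dlogU K a b)]
  refine Submodule.add_mem_sup h ?_
  exact Submodule.smul_mem _ (⟨_, hr⟩ : chartAtD K a b) (Submodule.mem_span_singleton_self _)

/-- The coefficients of the expansion in the fibre coordinate of the second chart. -/
theorem sum_smul_eq_invX_pow_mul (C : ℕ → MvPolynomial (Fin 2) K) (n : ℕ) :
    ∑ ij ∈ Finset.HasAntidiagonal.antidiagonal n, (1 / (ij.1 ! : K)) •
      ((-((2⁻¹ : K) • (ocoord K a b 1 * invX K a b))) ^ ij.1 *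
        MvPolynomial.aeval ![ocoord K a b 0, ocoord K a b 1] (C ij.2))
      = invX K a b ^ n *
        MvPolynomial.aeval ![ocoord K a b 0, ocoord K a b 1] (chartPoly C n) := by
  rw [chartPoly, map_sum, Finset.mul_sum]
  refine Finset.sum_congr rfl fun ij hij => ?_
  rw [Finset.HasAntidiagonal.mem_antidiagonal] at hij
  simp only [map_mul, MvPolynomial.algHom_C, map_pow, MvPolynomial.aeval_X, Matrix.cons_val_zero,
    Matrix.cons_val_one, ← hij]
  rw [← neg_smul, smul_pow, smul_mul_assoc, smul_smul, one_div, inv_mul_eq_div, Algebra.smul_def]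
  have hx := congrArg (· ^ ij.2) (ocoord_mul_invX (a := a) (b := b))
  simp only [one_pow, mul_pow] at hx
  set c := MvPolynomial.aeval ![ocoord K a b 0, ocoord K a b 1] (C ij.2)
  set r := algebraMap K (Overlap K a b) ((-2⁻¹) ^ ij.1 / (ij.1 ! : K))
  rw [mul_pow, pow_add]
  linear_combination (-r * ocoord K a b 1 ^ ij.1 * invX K a b ^ ij.1 * c) * hx

variable [CharZero K]

/-- The change of fibre coordinate `t = T - y/(2x)`: `e^{tw}` factors, and `e^{-yw/(2x)}` is
absorbed into the coefficients. -/
theorem aeval_ocoord_expPoly (C : ℕ → MvPolynomial (Fin 2) K) (n : ℕ) :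
    MvPolynomial.aeval (ocoord K a b) (expPoly C n)
      = ∑ ij ∈ Finset.HasAntidiagonal.antidiagonal n, (1 / (ij.1 ! : K)) •
        (locT K a b ^ ij.1 * (invX K a b ^ ij.2 *
          MvPolynomial.aeval ![ocoord K a b 0, ocoord K a b 1] (chartPoly C ij.2))) := by
  have ht : ocoord K a b 2
      = locT K a b + -((2⁻¹ : K) • (ocoord K a b 1 * invX K a b)) := by
    rw [locT]; abel
  rw [aeval_expPoly, ht,
    sum_exp_add_mul (fun j => MvPolynomial.aeval ![ocoord K a b 0, ocoord K a b 1] (C j))]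
  simp only [sum_smul_eq_invX_pow_mul]

theorem hasAlgResidue_polyForm (hab : a ^ 3 - 27 * b ^ 2 ≠ 0)
    {C : ℕ → MvPolynomial (Fin 2) K} (hC0 : C 0 = 1) (hC1 : C 1 = 0)
    (hC : ∀ n, 2 ≤ n → ∃ P Q : Polynomial K, P.natDegree ≤ n ∧ (Q = 0 ∨ Q.natDegree + 2 ≤ n) ∧
      MvPolynomial.aeval ![ocoord K a b 0, ocoord K a b 1] (chartPoly C n)
        = Polynomial.aeval (ocoord K a b 0) P
          + ocoord K a b 1 * Polynomial.aeval (ocoord K a b 0) Q) {n : ℕ} (hn : 1 ≤ n) :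
    HasAlgResidue K a b (polyForm a b (expPoly C n))
      (Polynomial.C (1 / ((n - 1)! : K)) * Polynomial.X ^ (n - 1)) := by
  have hmem : ∀ m, m ≠ 1 → invX K a b ^ m *
      MvPolynomial.aeval ![ocoord K a b 0, ocoord K a b 1] (chartPoly C m) ∈ chartAtD K a b := by
    intro m hm
    rcases Nat.lt_or_ge m 2 with h | h
    · obtain rfl : m = 0 := by omega
      rw [← sum_smul_eq_invX_pow_mul]
      simp [hC0, one_mem]
    · obtain ⟨P, Q, hP, hQ, e⟩ := hC m h
      rw [e]
      exact invX_pow_mul_reduced_mem hP hQ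
  have h1 : invX K a b ^ 1 *
      MvPolynomial.aeval ![ocoord K a b 0, ocoord K a b 1] (chartPoly C 1)
      = -((2⁻¹ : K) • (ocoord K a b 1 * invX K a b)) := by
    rw [← sum_smul_eq_invX_pow_mul]
    simp [Finset.Nat.antidiagonal_succ, hC0, hC1]
  rw [HasAlgResidue, restrictForm_polyForm hab, aeval_ocoord_expPoly]
  have hn1 : (n - 1, 1) ∈ Finset.HasAntidiagonal.antidiagonal n := by
    rw [Finset.HasAntidiagonal.mem_antidiagonal]
    exact Nat.sub_add_cancel hn
  -- The index `(n - 1, 1)` carries the coefficient `-y/(2x)` and hence the whole pole; all other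
  -- terms are regular multiples of `dx/y`.
  rw [← Finset.sum_erase_add _ _ hn1, add_smul, add_sub_assoc]
  refine add_mem ?_ ?_
  · refine smul_mem_regularAtD (sum_mem fun ij hij => ?_) invariantForm_mem
    rw [Finset.mem_erase, Finset.HasAntidiagonal.mem_antidiagonal] at hij
    refine Subalgebra.smul_mem _ (mul_mem (pow_mem locT_mem _) (hmem _ fun h => hij.1 ?_)) _
    ext
    · simp; omega
    · exact h
  · have e : Polynomial.aeval (locT K a b)
        (Polynomial.C (1 / ((n - 1)! : K)) * Polynomial.X ^ (n - 1))
        = (1 / ((n - 1)! : K)) • locT K a b ^ (n - 1) := by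
      rw [map_mul, Polynomial.aeval_C, map_pow, Polynomial.aeval_X, Algebra.smul_def]
    simp only [h1]
    rw [e, ← smul_mul_assoc, mul_smul, ← smul_sub]
    exact smul_mem_regularAtD (Subalgebra.smul_mem _ (pow_mem locT_mem _) _)
      smul_invariantForm_sub_dlogU_mem

end AlgForms

/-! ### Comparison of the analytic and algebraic forms -/

section Main

variable {L : PeriodPair} {k : Subfield ℂ} {a b : k}

theorem exists_twistPoly (h₂ : L.g₂ ∈ k) (h₃ : L.g₃ ∈ k) :
    ∃ C : ℕ → MvPolynomial (Fin 2) k, C 0 = 1 ∧ C 1 = 0 ∧ ∀ n, ∀ z ∉ L.lattice,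
      twistCoeff L n z = MvPolynomial.aeval ![L.weierstrassP z, L.derivWeierstrassP z] (C n) := by
  choose C hC using fun n => isPoly_twistCoeff (L := L) h₂ h₃ n
  -- The choice of representing polynomials is not canonical. The first two are fixed as `1` and `0`
  -- because the algebraic residue computation uses them as identities of polynomials.
  refine ⟨fun n => match n with | 0 => 1 | 1 => 0 | n + 2 => C (n + 2), rfl, rfl, ?_⟩
  intro n z hz
  match n with
  | 0 => rw [twistCoeff_zero L hz, map_one]
  | 1 => rw [twistCoeff_one hz, map_zero]
  | n + 2 => exact hC (n + 2) z hz

theorem aeval_unif_expPoly {C : ℕ → MvPolynomial (Fin 2) k}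
    (hC : ∀ n, ∀ z ∉ L.lattice, twistCoeff L n z =
      MvPolynomial.aeval ![L.weierstrassP z, L.derivWeierstrassP z] (C n))
    {p : ℂ × ℂ} (hp : p ∈ puncturedSet L) (n : ℕ) :
    MvPolynomial.aeval (unif L p) (expPoly C n) = coeffFun L n p.1 p.2 := by
  rw [coeffFun_eq_sum_twistCoeff L hp, aeval_expPoly]
  refine Finset.sum_congr rfl fun ij _ => ?_
  rw [hC _ _ hp, Algebra.smul_def]
  have : algebraMap k ℂ (1 / (ij.1 ! : k)) = 1 / (ij.1 ! : ℂ) := by simp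
  rw [this]
  simp only [unif, Matrix.cons_val]
  ring

/-- Substituting `dx = ℘' dz` and `dy = (6℘² - g₂/2) dz` turns the coefficients of `dx/y` into the
Bézout identity at `x = ℘`, leaving `f⁽ⁿ⁾ dz`. -/
theorem pullsBackTo_polyForm (hab : a ^ 3 - 27 * b ^ 2 ≠ 0)
    (hg₂ : L.g₂ = (a : ℂ)) (hg₃ : L.g₃ = (b : ℂ)) {C : ℕ → MvPolynomial (Fin 2) k}
    (hC : ∀ n, ∀ z ∉ L.lattice, twistCoeff L n z =
      MvPolynomial.aeval ![L.weierstrassP z, L.derivWeierstrassP z] (C n)) (n : ℕ) :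
    PullsBackTo k a b L (polyForm a b (expPoly C n)) (omegaForm L n) := by
  refine ⟨formCoeff a b (expPoly C n), rfl, fun p hp => ?_⟩
  have hB := bezout hab (unif L p)
  have ode := L.derivWeierstrassP_sq p.1 hp
  have d0 : fderiv ℂ (fun q => unif L q 0) p = L.derivWeierstrassP p.1 • dz :=
    ((hasDerivAt_weierstrassP L hp).comp_hasFDerivAt p hasFDerivAt_fst).fderiv
  have d1 : fderiv ℂ (fun q => unif L q 1) p = (6 * L.weierstrassP p.1 ^ 2 - L.g₂ / 2) • dz :=
    ((hasDerivAt_derivWeierstrassP L hp).comp_hasFDerivAt p hasFDerivAt_fst).fderiv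
  have ha : algebraMap k ℂ a = L.g₂ := hg₂.symm
  have hb : algebraMap k ℂ b = L.g₃ := hg₃.symm
  have u0 : unif L p 0 = L.weierstrassP p.1 := rfl
  have u1 : unif L p 1 = L.derivWeierstrassP p.1 := rfl
  rw [ha, hb, u0, ← ode] at hB
  rw [Fin.sum_univ_three, d0, d1]
  simp only [formCoeff, Matrix.cons_val, map_mul, map_zero, MvPolynomial.aeval_X, map_ofNat, u1,
    aeval_unif_expPoly hC hp]
  ext <;> simp [omegaForm, dz]
  linear_combination (-coeffFun L n p.1 p.2) * hB

end Main

end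

end UnivExt

end

theorem mainTheorem3 (k : Subfield ℂ) (a b : k) (hab : a ^ 3 - 27 * b ^ 2 ≠ 0)
    (L : PeriodPair) (hg₂ : L.g₂ = (a : ℂ)) (hg₃ : L.g₃ = (b : ℂ)) :
    (∀ z s : ℂ, z ∉ L.lattice → ∀ᶠ w in 𝓝[≠] (0 : ℂ),
      HasSum (fun n : ℕ => UnivExt.coeffFun L n z s * w ^ ((n : ℤ) - 1))
        (UnivExt.genFun L z s w)) ∧
    (∀ n : ℕ, 1 ≤ n →
      UnivExt.Descends L (UnivExt.omegaForm L n) ∧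
      AnalyticOnNhd ℂ (UnivExt.omegaForm L n) (UnivExt.puncturedSet L) ∧
      UnivExt.HasPoleWithResidue L (UnivExt.omegaForm L n)
        (Polynomial.C (1 / ((n - 1)! : ℂ)) * Polynomial.X ^ (n - 1))) ∧
    (∀ n : ℕ, 1 ≤ n → ∃ α ∈ UnivExt.logForms k a b,
      UnivExt.PullsBackTo k a b L α (UnivExt.omegaForm L n) ∧
      UnivExt.HasAlgResidue k a b α
        (Polynomial.C (1 / ((n - 1)! : k)) * Polynomial.X ^ (n - 1))) ∧
    (∀ p ∈ UnivExt.puncturedSet L,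
      extDeriv (UnivExt.toForm (UnivExt.nuForm L)) p = 0 ∧
      extDeriv (UnivExt.toForm (UnivExt.omegaForm L 0)) p = 0 ∧
      ∀ n : ℕ, 1 ≤ n → extDeriv (UnivExt.toForm (UnivExt.omegaForm L n)) p =
        -UnivExt.wedge (UnivExt.nuForm L p) (UnivExt.omegaForm L (n - 1) p)) := by
  have h₂ : L.g₂ ∈ k := hg₂ ▸ a.2
  have h₃ : L.g₃ ∈ k := hg₃ ▸ b.2
  refine ⟨fun z s hz => UnivExt.hasSum_genFun L hz s, fun n hn =>
    ⟨UnivExt.descends_omegaForm L n, UnivExt.analyticOnNhd_omegaForm L n,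
      UnivExt.hasPoleWithResidue_omegaForm L hn⟩, fun n hn => ?_, fun p hp =>
    ⟨UnivExt.extDeriv_nuForm L hp, UnivExt.extDeriv_omegaForm_zero L hp, fun n hn => ?_⟩⟩
  · obtain ⟨C, hC0, hC1, hC⟩ := UnivExt.exists_twistPoly h₂ h₃
    have hres := UnivExt.hasAlgResidue_polyForm hab hC0 hC1 (fun m hm => by
      obtain ⟨P, Q, hP, hQ, e⟩ := UnivExt.exists_reduced_chartPoly hg₂ hg₃ hC hm
      -- Here the reduction, whose degrees were bounded analytically, is specialised to the ring of
      -- the overlap.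
      exact ⟨P, Q, hP, hQ, e (UnivExt.Overlap k a b) _ _
        (by rw [UnivExt.ocoord_cubic, UnivExt.aeval_cubic])⟩) hn
    exact ⟨_, UnivExt.mem_logForms_of_hasAlgResidue hres,
      UnivExt.pullsBackTo_polyForm hab hg₂ hg₃ hC n, hres⟩
  · obtain ⟨m, rfl⟩ := Nat.exists_eq_add_of_le' hn
    exact UnivExt.extDeriv_omegaForm_succ L hp m
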